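/- Let $n\ge 0$ and $T>0$, and write $J=\begin{pmatrix}0&-I_n\\ I_n&0\end{pmatrix}$ and $\omega(z_1,z_2)=\langle Jz_1,z_2\rangle$ on $\mathbb R^{2n}$. Let $t\mapsto P(t)$, $t\in[0,T]$, be a $C^1$ (not necessarily constant) path of symmetric invertible real $n\times n$ matrices, and let $A\in O(n)$ satisfy $P(0)=A\,P(T)\,A^{\mathsf T}$. Consider the Sturm–Liouville system $$-\frac{d}{dt}\bigl(P(t)x'(t)\bigr)+s_0P(t)x(t)=0,\qquad t\in[0,T],$$ with the twisted boundary conditions $x(0)=Ax(T)$, $x'(0)=Ax'(T)$. In the variables $z=(Px',x)$ the equation is the Hamiltonian system $z'(t)=JB_{0,s_0}(t)z(t)$ with $B_{0,s_0}(t)=\begin{pmatrix}P(t)^{-1}&0\\0&-s_0P(t)\end{pmatrix}$; let $\psi_{0,s_0}:[0,T]\to \mathrm{Sp}(2n,\mathbb R)$ be its fundamental solution, $\psi_{0,s_0}(0)=I_{2n}$. Put $A_d=\begin{pmatrix}A&0\\0&A\end{pmatrix}$, and for a $2n\times 2n$ matrix $M$ let $\mathrm{Gr}(M)=\{(x,Mx):x\in\mathbb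 R^{2n}\}$, which is Lagrangian in $(\mathbb R^{2n}\times\mathbb R^{2n},-\omega\times\omega)$ if $M$ is symplectic. For a Lagrangian subspace $L_0$ and a continuous path $\ell$ of Lagrangian subspaces of $(\mathbb R^{2n}\times\mathbb R^{2n},-\omega\times\omega)$ let $$\iota_{\mathrm{CLM}}(L_0,\ell(t),t\in[a,b])=\bigl[e^{-\varepsilon\mathcal J}\ell(t):\Sigma(L_0)\bigr],\qquad 0<\varepsilon\ll1,$$ where $\mathcal J=(-J)\times J$ and the right-hand side is the intersection number with the Maslov cycle $\Sigma(L_0)=\{L:L\cap L_0\neq0\}$, co-oriented so that $\theta\mapsto e^{\theta\mathcal J}L$ crosses it in the positive direction. (This intersection number is computed on a subdivision of $[a,b]$, on each interval $[\tau_i,\tau_{i+1}]$ of which the path stays transverse to a Lagrangian complement $M_i$ of $L_0$, as the sum of the increments from $\tau_i$ to $\tau_{i+1}$ of the number of positive squares of the quadratic form $v\mapsto(-\omega\times\omega)(v,w)$ on $L_0$, where $w\in M_i$ is determined by $v+w$ belonging to the moving Lagrangian subspace.) Then there is $\sigma\ge0$, depending on $n$, $T$, $P$ and $A$, such that for every $s_0\ge\sigma$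 the index below is well defined and $$\iota_{\mathrm{CLM}}\bigl(\mathrm{Gr}(A_d^{\mathsf T}),\ \mathrm{Gr}(\psi_{0,s_0}(t)),\ t\in[0,T]\bigr)=\dim\ker(A-I_n).$$ -/

import Mathlib

open Set
open scoped Matrix

namespace SturmMaslov

/-! ### Lagrangian subspaces and the Maslov index of a Lagrangian path -/

/-- `L` is Lagrangian for the symplectic form `Ω`: it equals its symplectic orthogonal. -/
def IsLagrangian {V : Type*} [AddCommGroup V] [Module ℝ V]
    (Ω : LinearMap.BilinForm ℝ V) (L : Submodule ℝ V) : Prop :=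
  Ω.orthogonal L = L

/-- Let `M` be a Lagrangian complement of both `L₀` and `L`. For `v ∈ L₀` there is a unique
`w(v) ∈ M` with `v + w(v) ∈ L`, and `v ↦ Ω(v, w(v))` is a quadratic form on `L₀` (the coordinate
of `L` in the chart of the Lagrangian Grassmannian centred at `L₀` with complement `M`), whose
kernel is `L ∩ L₀`. This is its coindex: the maximal dimension of a subspace of `L₀` on which it is
positive definite. -/
noncomputable def chartCoindex {V : Type*} [AddCommGroup V] [Module ℝ V]
    (Ω : LinearMap.BilinForm ℝ V) (L₀ M L : Submodule ℝ V) : ℕ :=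
  sSup {d : ℕ | ∃ P : Submodule ℝ V, P ≤ L₀ ∧ Module.finrank ℝ P = d ∧
    ∀ v ∈ P, v ≠ 0 → ∀ w ∈ M, v + w ∈ L → 0 < Ω v w}

/-- `k` is the intersection number of the continuous Lagrangian path `ℓ : [a, b] → Λ(V, Ω)`,
whose endpoints are transverse to `L₀`, with the co-oriented Maslov cycle
`Σ(L₀) = {L | L ∩ L₀ ≠ 0}`: there are a subdivision `a = τ 0 ≤ ⋯ ≤ τ N = b` and Lagrangian
subspaces `M i` such that `ℓ` stays on `[τ i, τ (i+1)]` in the chart of complement `M i`, and `k`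
is the sum of the increments of the coindex in these charts. (Where a path crosses the top stratum
of the cycle transversally, an eigenvalue of the chart form changes sign; the crossing counts `+1`
if the eigenvalue becomes positive and `-1` if it becomes negative.) -/
def IsIntersectionNumber {V : Type*} [AddCommGroup V] [Module ℝ V]
    (Ω : LinearMap.BilinForm ℝ V) (L₀ : Submodule ℝ V) (ℓ : ℝ → Submodule ℝ V) (a b : ℝ)
    (k : ℤ) : Prop :=
  ℓ a ⊓ L₀ = ⊥ ∧ ℓ b ⊓ L₀ = ⊥ ∧
  ∃ (N : ℕ) (τ : Fin (N + 1) → ℝ) (M : Fin N → Submodule ℝ V),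
    Monotone τ ∧ τ 0 = a ∧ τ (Fin.last N) = b ∧
    (∀ i : Fin N, IsLagrangian Ω (M i) ∧ IsCompl (M i) L₀ ∧
      ∀ t ∈ Icc (τ i.castSucc) (τ i.succ), IsCompl (M i) (ℓ t)) ∧
    k = ∑ i : Fin N, ((chartCoindex Ω L₀ (M i) (ℓ (τ i.succ)) : ℤ)
      - (chartCoindex Ω L₀ (M i) (ℓ (τ i.castSucc)) : ℤ))

/-- For a complex structure `𝒥` (`𝒥² = -1`), the exponential `e^{θ𝒥} = cos θ + sin θ 𝒥`. -/
noncomputable def rotation {V : Type*} [AddCommGroup V] [Module ℝ V]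
    (𝒥 : V →ₗ[ℝ] V) (θ : ℝ) : V →ₗ[ℝ] V :=
  Real.cos θ • LinearMap.id + Real.sin θ • 𝒥

/-- `k` is the Maslov index `ι_CLM(L₀, ℓ(t); t ∈ [a, b])`: for all sufficiently small `ε > 0`, it
is the intersection number of the path `t ↦ e^{-ε𝒥} ℓ(t)` with the Maslov cycle of `L₀`. -/
def IsCLMIndex {V : Type*} [AddCommGroup V] [Module ℝ V]
    (Ω : LinearMap.BilinForm ℝ V) (𝒥 : V →ₗ[ℝ] V) (L₀ : Submodule ℝ V)
    (ℓ : ℝ → Submodule ℝ V) (a b : ℝ) (k : ℤ) : Prop :=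
  ∃ ε₀ > (0 : ℝ), ∀ ε ∈ Ioo 0 ε₀,
    IsIntersectionNumber Ω L₀ (fun t => (ℓ t).map (rotation 𝒥 (-ε))) a b k

/-! ### Graphs in `(ℝ²ⁿ × ℝ²ⁿ, -ω × ω)` -/

/-- `ℝ²ⁿ = ℝⁿ ⊕ ℝⁿ`, momenta in the first summand, positions in the second. -/
abbrev PhaseSpace (n : ℕ) : Type := Fin n ⊕ Fin n → ℝ

/-- The standard symplectic form `ω(z₁, z₂) = ⟨J z₁, z₂⟩`, with `J = [[0, -I], [I, 0]]`. -/
noncomputable def omega (n : ℕ) : LinearMap.BilinForm ℝ (PhaseSpace n) :=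
  Matrix.toBilin' (Matrix.J (Fin n) ℝ)ᵀ

theorem omega_apply (n : ℕ) (z₁ z₂ : PhaseSpace n) :
    omega n z₁ z₂ = (Matrix.J (Fin n) ℝ *ᵥ z₁) ⬝ᵥ z₂ := by
  rw [omega, Matrix.toBilin'_apply', Matrix.mulVec_transpose, dotProduct_comm,
    ← Matrix.dotProduct_mulVec, dotProduct_comm]

/-- The symplectic form `-ω × ω` on `ℝ²ⁿ × ℝ²ⁿ`. -/
noncomputable def graphForm (n : ℕ) : LinearMap.BilinForm ℝ (PhaseSpace n × PhaseSpace n) :=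
  -((omega n).compl₁₂ (LinearMap.fst ℝ _ _) (LinearMap.fst ℝ _ _))
    + (omega n).compl₁₂ (LinearMap.snd ℝ _ _) (LinearMap.snd ℝ _ _)

/-- The complex structure `(-J) × J` that represents `-ω × ω` with respect to the Euclidean
product of `ℝ²ⁿ × ℝ²ⁿ`. -/
noncomputable def graphJ (n : ℕ) :
    PhaseSpace n × PhaseSpace n →ₗ[ℝ] PhaseSpace n × PhaseSpace n :=
  LinearMap.prodMap (-(Matrix.J (Fin n) ℝ).mulVecLin) (Matrix.J (Fin n) ℝ).mulVecLin

/-- The graph `{(x, M x)}` of a `2n × 2n` matrix. -/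
noncomputable def Gr {n : ℕ} (M : Matrix (Fin n ⊕ Fin n) (Fin n ⊕ Fin n) ℝ) :
    Submodule ℝ (PhaseSpace n × PhaseSpace n) :=
  M.mulVecLin.graph

/-! ### The Hamiltonian system of `-(P x')' + s P x = 0` -/

/-- `A_d = diag(A, A)`. -/
def diag₂ {n : ℕ} (A : Matrix (Fin n) (Fin n) ℝ) :
    Matrix (Fin n ⊕ Fin n) (Fin n ⊕ Fin n) ℝ :=
  Matrix.fromBlocks A 0 0 A

/-- The coefficient `B_{0,s}(t) = diag(P(t)⁻¹, -s P(t))`. In the variables `z = (P x', x)` the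
system `-(P x')' + s P x = 0` is `z' = J B_{0,s} z`. -/
noncomputable def hamB {n : ℕ} (P : ℝ → Matrix (Fin n) (Fin n) ℝ) (s t : ℝ) :
    Matrix (Fin n ⊕ Fin n) (Fin n ⊕ Fin n) ℝ :=
  Matrix.fromBlocks (P t)⁻¹ 0 0 (-(s • P t))

/-- `ψ` is the fundamental solution of `z' = J B(t) z` on `[0, T]`: the matrix solution with
`ψ(0) = I`. -/
def IsFundamentalSolution {n : ℕ} (B : ℝ → Matrix (Fin n ⊕ Fin n) (Fin n ⊕ Fin n) ℝ) (T : ℝ)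
    (ψ : ℝ → Matrix (Fin n ⊕ Fin n) (Fin n ⊕ Fin n) ℝ) : Prop :=
  ψ 0 = 1 ∧ ∀ t ∈ Icc 0 T, ∀ i j,
    HasDerivWithinAt (fun r => ψ r i j) ((Matrix.J (Fin n) ℝ * B t * ψ t) i j) (Icc 0 T) t

end SturmMaslov

/-!
The Maslov index is computed in a single chart of the Lagrangian Grassmannian. Write points of
`ℝ²ⁿ × ℝ²ⁿ` as `((y₁, x₁), (y₂, x₂))`. The Lagrangian subspace `{x₁ = 0, y₂ = 0}` (`mixedPlane`) is a
complement of `Gr(A_dᵀ)`, and it meets `Gr(ψ t)` exactly in the solutions with `x(0) = 0` and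
`y(t) = 0`. For large `s` there are none but zero: the function `⟨x, P⁻¹ y⟩ = ⟨x, x'⟩` has derivative
`|x'|² + s |x|²` up to a term of size `O(|x| |x'|)`, so it is strictly increasing along nonzero
solutions, whatever the signature of `P` (`exists_threshold`). By compactness the same holds for
the path rotated by a small angle. In this chart the Lagrangian `Gr(ψ t)` has the quadratic form
`x₁·y₁ + y₂·x₂ - 2 x₁·A y₂`, pulled back by `z ↦ (z, ψ t z)` (`chartCoindex_range_eq`).

The index does not depend on the subdivision and the charts used to compute it. For two charts, the
direct sums of the two chart forms with suitable auxiliary forms are isometric, and along the path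
the auxiliary forms are nondegenerate, hence of constant signature (`sigPos_change_of_chart`,
`IsIntersectionNumber.eq_chartCoindex_sub`). So the index is the difference of the positive indices
of the form above at the times `T` and `0`.

At time `T` the form is joined to the form `2 x·y` of signature zero by letting `t` decrease to `0`
in `x₁·y₁ + y₂·x₂ - 2θ x₁·A y₂` after `θ` has moved from `1` to `0`. A vector in the radical of one of
these forms is a solution with `y(0) = θ A y(t)` and `x(t) = θ Aᵀ x(0)`, where `θ = 0` or `t = T`; since
`P(0) = A P(T) Aᵀ`, the increasing function takes equal values at `0` and `t`, so the solution
vanishes (`SeparatesTimes.radical_eq_bot`). Hence the positive index at time `T` is `n`.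

At time `0` the form is explicit. On two copies of the range of `A - 1` it is nondegenerate of
signature zero, and on two copies of the kernel of `A - 1`, where it vanishes, the rotation by a
small positive angle makes it negative definite (`eventually_sigPos_initial`). Hence the positive
index at time `0` is `n - dim ker (A - 1)`, and the Maslov index is `dim ker (A - 1)`.
-/

open Filter Topology

namespace SturmMaslov

/-! ### Signatures of quadratic forms -/

section Signature

variable {E F : Type*} [AddCommGroup E] [Module ℝ E] [AddCommGroup F] [Module ℝ F]

/-- A quadratic form that becomes positive definite after pulling back along `f` is positive
definite on the range of `f`, and `f` is automatically injective. -/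
theorem finrank_le_sigPos_of_comp_posDef [FiniteDimensional ℝ E] {Q : QuadraticForm ℝ E}
    (f : F →ₗ[ℝ] E) (h : (Q.comp f).PosDef) : Module.finrank ℝ F ≤ sigPos Q := by
  have hinj : Function.Injective f := by
    rw [← LinearMap.ker_eq_bot, LinearMap.ker_eq_bot']
    intro x hx
    by_contra hne
    have := h x hne
    simp [hx] at this
  rw [← LinearMap.finrank_range_of_inj hinj]
  refine le_sigPos_of_posDef Q ?_
  rintro ⟨_, x, rfl⟩ hx
  refine h x ?_
  rintro rfl
  simp at hx

theorem sigPos_comp_equiv (Q : QuadraticForm ℝ E) (e : F ≃ₗ[ℝ] E) :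
    sigPos (Q.comp (e : F →ₗ[ℝ] E)) = sigPos Q :=
  QuadraticMap.Equivalent.sigPos_eq ⟨⟨e, fun _ => rfl⟩⟩

theorem mem_radical_iff_polar {Q : QuadraticForm ℝ E} {x : E} :
    x ∈ Q.radical ↔ ∀ y, QuadraticMap.polar Q x y = 0 := by
  rw [QuadraticMap.radical_eq_ker_polarBilin, LinearMap.mem_ker, LinearMap.ext_iff]
  simp

variable [FiniteDimensional ℝ E] [FiniteDimensional ℝ F]

theorem sigPos_add_sigNeg_of_radical_eq_bot {Q : QuadraticForm ℝ E} (h : Q.radical = ⊥) :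
    sigPos Q + sigNeg Q = Module.finrank ℝ E := by
  have := QuadraticForm.sigPos_add_sigNeg_add_radical (Q := Q)
  rwa [h, finrank_bot, add_zero] at this

theorem sigPos_add_le_sigPos_prod (Q : QuadraticForm ℝ E) (R : QuadraticForm ℝ F) :
    sigPos Q + sigPos R ≤ sigPos (Q.prod R) := by
  obtain ⟨V, hV, hVp⟩ := exists_finrank_eq_sigPos_and_posDef Q
  obtain ⟨W, hW, hWp⟩ := exists_finrank_eq_sigPos_and_posDef R
  rw [← hV, ← hW, ← Module.finrank_prod]
  exact finrank_le_sigPos_of_comp_posDef (V.subtype.prodMap W.subtype) (hVp.prod hWp)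

/-- The positive index of inertia is additive under orthogonal sums. -/
theorem sigPos_prod (Q : QuadraticForm ℝ E) (R : QuadraticForm ℝ F) :
    sigPos (Q.prod R) = sigPos Q + sigPos R := by
  -- The positive and negative indices and the nullity are each superadditive; since they sum to the
  -- dimension, none of the three inequalities can be strict.
  have h1 := sigPos_add_le_sigPos_prod Q R
  have h2 : sigNeg Q + sigNeg R ≤ sigNeg (Q.prod R) := by
    have h := sigPos_add_le_sigPos_prod (-Q) (-R)
    have e : (-Q).prod (-R) = -(Q.prod R) := by ext x; simp; ring
    rwa [e] at h
  have h3 : Module.finrank ℝ Q.radical + Module.finrank ℝ R.radical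
      ≤ Module.finrank ℝ (Q.prod R).radical := by
    rw [← Module.finrank_prod]
    refine LinearMap.finrank_le_finrank_of_injective
      (f := (Q.radical.subtype.prodMap R.radical.subtype).codRestrict _ ?_) ?_
    · rintro ⟨⟨x, hx⟩, ⟨y, hy⟩⟩
      rw [mem_radical_iff_polar] at hx hy ⊢
      rintro ⟨x', y'⟩
      simp [hx, hy]
    · rw [LinearMap.injective_codRestrict_iff]
      exact Q.radical.injective_subtype.prodMap R.radical.injective_subtype
  have a1 := QuadraticForm.sigPos_add_sigNeg_add_radical (Q := Q)
  have a2 := QuadraticForm.sigPos_add_sigNeg_add_radical (Q := R)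
  have a3 := QuadraticForm.sigPos_add_sigNeg_add_radical (Q := Q.prod R)
  rw [Module.finrank_prod] at a3
  omega

/-- Positive definiteness is an open condition for pointwise convergence of quadratic forms on a
finite-dimensional space. -/
theorem eventually_posDef_of_tendsto {ι : Type*} {l : Filter ι} {Q : ι → QuadraticForm ℝ E}
    {Q₀ : QuadraticForm ℝ E} (hQ : ∀ v, Tendsto (fun i => Q i v) l (𝓝 (Q₀ v)))
    (h₀ : Q₀.PosDef) : ∀ᶠ i in l, (Q i).PosDef := by
  let b := Module.finBasis ℝ E
  let d := Module.finrank ℝ E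
  let m : QuadraticForm ℝ E → Matrix (Fin d) (Fin d) ℝ := fun R =>
    LinearMap.BilinForm.toMatrix b (QuadraticMap.associated R)
  have hm : ∀ (R : QuadraticForm ℝ E) v, R v = b.equivFun v ⬝ᵥ (m R *ᵥ b.equivFun v) := by
    intro R v
    change R v = b.repr v ⬝ᵥ (m R *ᵥ b.repr v)
    rw [← LinearMap.BilinForm.apply_eq_dotProduct_toMatrix_mulVec b,
      QuadraticMap.associated_eq_self_apply]
  have hlim : Tendsto (fun i => m (Q i)) l (𝓝 (m Q₀)) := by
    refine tendsto_pi_nhds.2 fun i => tendsto_pi_nhds.2 fun j => ?_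
    simp only [m, LinearMap.BilinForm.toMatrix_apply, QuadraticMap.associated_apply]
    exact (((hQ _).sub (hQ _)).sub (hQ _)).const_smul _
  -- On the compact unit sphere, positivity persists for all Gram matrices near that of `Q₀`.
  have key : ∀ᶠ N in 𝓝 (m Q₀), ∀ x ∈ Metric.sphere (0 : Fin d → ℝ) 1, 0 < x ⬝ᵥ (N *ᵥ x) := by
    refine (isCompact_sphere _ _).eventually_forall_of_forall_eventually fun x hx => ?_
    have hc : Continuous fun z : Matrix (Fin d) (Fin d) ℝ × (Fin d → ℝ) =>
        z.2 ⬝ᵥ (z.1 *ᵥ z.2) := by fun_prop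
    refine hc.continuousAt.eventually (lt_mem_nhds ?_)
    have hx0 : x ≠ 0 := by rintro rfl; simp at hx
    have := h₀ (b.equivFun.symm x) (by rwa [Ne, LinearEquiv.map_eq_zero_iff])
    rwa [hm, LinearEquiv.apply_symm_apply] at this
  filter_upwards [hlim.eventually key] with i hi v hv
  have hx0 : b.equivFun v ≠ 0 := by simpa using hv
  have hn : 0 < ‖b.equivFun v‖ := norm_pos_iff.2 hx0
  have := hi (‖b.equivFun v‖⁻¹ • b.equivFun v) (by
    rw [mem_sphere_zero_iff_norm, norm_smul, norm_inv, norm_norm, inv_mul_cancel₀ hn.ne'])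
  rw [Matrix.mulVec_smul, smul_dotProduct, dotProduct_smul, smul_smul, smul_eq_mul] at this
  rw [hm]
  exact (mul_pos_iff_of_pos_left (by positivity)).1 this

theorem eventually_sigPos_le_of_tendsto {ι : Type*} {l : Filter ι} {Q : ι → QuadraticForm ℝ E}
    {Q₀ : QuadraticForm ℝ E} (hQ : ∀ v, Tendsto (fun i => Q i v) l (𝓝 (Q₀ v))) :
    ∀ᶠ i in l, sigPos Q₀ ≤ sigPos (Q i) := by
  obtain ⟨V, hV, hVp⟩ := exists_finrank_eq_sigPos_and_posDef Q₀
  filter_upwards [eventually_posDef_of_tendsto (Q := fun i => (Q i).restrict V)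
    (fun v => by simpa using hQ v) hVp] with i hi
  rw [← hV]
  exact le_sigPos_of_posDef _ hi

/-- Near a nondegenerate quadratic form, forms are nondegenerate of the same signature. -/
theorem eventually_sigPos_eq_of_tendsto {ι : Type*} {l : Filter ι} {Q : ι → QuadraticForm ℝ E}
    {Q₀ : QuadraticForm ℝ E} (hQ : ∀ v, Tendsto (fun i => Q i v) l (𝓝 (Q₀ v)))
    (h₀ : Q₀.radical = ⊥) : ∀ᶠ i in l, sigPos (Q i) = sigPos Q₀ ∧ (Q i).radical = ⊥ := by
  filter_upwards [eventually_sigPos_le_of_tendsto hQ,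
    eventually_sigPos_le_of_tendsto (Q := fun i => -Q i) (Q₀ := -Q₀)
      (fun v => by simpa using (hQ v).neg)] with i h1 h2
  rw [sigPos_neg, sigPos_neg] at h2
  have h3 := sigPos_add_sigNeg_of_radical_eq_bot h₀
  have h4 := QuadraticForm.sigPos_add_sigNeg_add_radical (Q := Q i)
  exact ⟨by omega, Submodule.finrank_eq_zero.1 (by omega)⟩

/-- The signature does not change along a continuous path of nondegenerate quadratic forms. -/
theorem sigPos_eq_of_continuousOn {S : Set ℝ} (hS : IsPreconnected S)
    {Q : ℝ → QuadraticForm ℝ E} (hQ : ∀ v, ContinuousOn (fun t => Q t v) S)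
    (hr : ∀ t ∈ S, (Q t).radical = ⊥) {a b : ℝ} (ha : a ∈ S) (hb : b ∈ S) :
    sigPos (Q a) = sigPos (Q b) := by
  refine hS.constant (f := fun t => sigPos (Q t)) (fun t ht => ?_) ha hb
  refine tendsto_nhds_of_eventually_eq ?_
  filter_upwards [eventually_sigPos_eq_of_tendsto (fun v => hQ v t ht) (hr t ht)] with i hi
  exact hi.1

end Signature

/-! ### Charts of the Lagrangian Grassmannian -/

section Charts

/-- If `v z ∈ L₀` and `w z ∈ M` are the two components of an injective parametrization
`z ↦ v z + w z` of `L`, the chart form is read off on the parameter space. -/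
theorem chartCoindex_eq_sigPos {V Z : Type*} [AddCommGroup V] [Module ℝ V]
    [FiniteDimensional ℝ V] [AddCommGroup Z] [Module ℝ Z] [FiniteDimensional ℝ Z]
    (Ω : LinearMap.BilinForm ℝ V) {L₀ M : Submodule ℝ V} (v w : Z →ₗ[ℝ] V)
    (hv : ∀ z, v z ∈ L₀) (hw : ∀ z, w z ∈ M) (hinj : Function.Injective (v + w))
    (hcompl : IsCompl M (LinearMap.range (v + w)))
    (hdim : Module.finrank ℝ Z = Module.finrank ℝ L₀) :
    chartCoindex Ω L₀ M (LinearMap.range (v + w)) =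
      sigPos (LinearMap.BilinMap.toQuadraticMap (Ω.compl₁₂ v w)) := by
  set L := LinearMap.range (v + w) with hL
  have hvinj : Function.Injective (v.codRestrict L₀ hv) := by
    rw [LinearMap.injective_codRestrict_iff, ← LinearMap.ker_eq_bot, LinearMap.ker_eq_bot']
    intro z hz
    have h1 : (v + w) z ∈ M := by simpa [hz] using hw z
    have h2 : (v + w) z = 0 := (Submodule.disjoint_def.1 hcompl.disjoint) _ h1 ⟨z, rfl⟩
    exact hinj (by rw [h2, map_zero])
  let e : Z ≃ₗ[ℝ] L₀ := LinearEquiv.ofInjectiveOfFinrankEq _ hvinj hdim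
  have he : ∀ z, (e z : V) = v z := fun z => rfl
  have hform : ∀ z, ∀ w' ∈ M, v z + w' ∈ L → Ω (v z) w' = Ω (v z) (w z) := by
    intro z w' hw' hmem
    have : w' - w z ∈ L := by
      have := L.sub_mem hmem (⟨z, rfl⟩ : (v + w) z ∈ L)
      simpa using this
    have := (Submodule.disjoint_def.1 hcompl.disjoint) _ (M.sub_mem hw' (hw z)) this
    rw [sub_eq_zero.1 this]
  refine IsGreatest.csSup_eq ⟨?_, ?_⟩
  · obtain ⟨P, hP, hPp⟩ := exists_finrank_eq_sigPos_and_posDef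
      (LinearMap.BilinMap.toQuadraticMap (Ω.compl₁₂ v w))
    refine ⟨P.map v, ?_, ?_, ?_⟩
    · rintro _ ⟨z, -, rfl⟩
      exact hv z
    · rw [← hP]
      exact (Submodule.equivMapOfInjective v (fun _ _ h => hvinj (Subtype.ext h)) P).finrank_eq.symm
    · rintro _ ⟨z, hz, rfl⟩ hne w' hw' hmem
      rw [hform z w' hw' hmem]
      refine hPp ⟨z, hz⟩ ?_
      rintro h
      rw [Submodule.mk_eq_zero] at h
      simp [h] at hne
  · rintro _ ⟨P, hP, rfl, hpos⟩
    refine finrank_le_sigPos_of_comp_posDef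
      ((e.symm : L₀ →ₗ[ℝ] Z).comp (Submodule.inclusion hP)) fun x hx => ?_
    set z := e.symm (Submodule.inclusion hP x) with hz
    have hzx : v z = x := by rw [← he, hz, LinearEquiv.apply_symm_apply]; rfl
    change 0 < Ω (v z) (w z)
    have := hpos x x.2 (by simpa using hx) (w z) (hw z) (by rw [← hzx]; exact ⟨z, rfl⟩)
    rwa [← hzx] at this

/-- The effect of a change of chart on the positive index. In the chart with complement `Y` a
moving Lagrangian subspace, parametrized by `Z`, is the graph of `a z ↦ c z`; in the chart whose
complement is the graph of `B` it is the graph of a form isometric to `p (a z - B c z) (c z)`.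
Both forms differ, up to stabilization by a fixed form, by the nondegenerate form
`-p (a u) (c u) + 2 p (a u) y - p (B y) y`, so the difference of the positive indices is constant
along the path. -/
theorem sigPos_change_of_chart {X Y Z : Type*}
    [AddCommGroup X] [Module ℝ X] [FiniteDimensional ℝ X]
    [AddCommGroup Y] [Module ℝ Y] [FiniteDimensional ℝ Y]
    [AddCommGroup Z] [Module ℝ Z] [FiniteDimensional ℝ Z]
    (p : X →ₗ[ℝ] Y →ₗ[ℝ] ℝ) (B : Y →ₗ[ℝ] X)
    (hB : ∀ y y', p (B y) y' = p (B y') y)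
    (hpX : ∀ x, (∀ y, p x y = 0) → x = 0) (hpY : ∀ y, (∀ x, p x y = 0) → y = 0)
    {S : Set ℝ} (hS : IsPreconnected S) (a : ℝ → Z →ₗ[ℝ] X) (c : ℝ → Z →ₗ[ℝ] Y)
    (hac : ∀ t ∈ S, ∀ z z', p (a t z) (c t z') = p (a t z') (c t z))
    (ha : ∀ t ∈ S, Function.Bijective (a t))
    (haB : ∀ t ∈ S, Function.Injective (a t - B ∘ₗ c t))
    (hcont₁ : ∀ z, ContinuousOn (fun t => p (a t z) (c t z)) S)
    (hcont₂ : ∀ z y, ContinuousOn (fun t => p (a t z) y) S)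
    {t t' : ℝ} (ht : t ∈ S) (ht' : t' ∈ S) :
    sigPos (LinearMap.BilinMap.toQuadraticMap (p.compl₁₂ (a t - B ∘ₗ c t) (c t)))
      + sigPos (LinearMap.BilinMap.toQuadraticMap (p.compl₁₂ (a t') (c t')))
    = sigPos (LinearMap.BilinMap.toQuadraticMap (p.compl₁₂ (a t' - B ∘ₗ c t') (c t')))
      + sigPos (LinearMap.BilinMap.toQuadraticMap (p.compl₁₂ (a t) (c t))) := by
  let K : QuadraticForm ℝ (X × Y) := LinearMap.BilinMap.toQuadraticMap
    ((2 : ℝ) • p.compl₁₂ (LinearMap.fst ℝ X Y) (LinearMap.snd ℝ X Y)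
      - p.compl₁₂ (B ∘ₗ LinearMap.snd ℝ X Y) (LinearMap.snd ℝ X Y))
  let N : ℝ → QuadraticForm ℝ (Z × Y) := fun t => LinearMap.BilinMap.toQuadraticMap
    ((2 : ℝ) • p.compl₁₂ (a t ∘ₗ LinearMap.fst ℝ Z Y) (LinearMap.snd ℝ Z Y)
      - p.compl₁₂ (B ∘ₗ LinearMap.snd ℝ Z Y) (LinearMap.snd ℝ Z Y)
      - p.compl₁₂ (a t ∘ₗ LinearMap.fst ℝ Z Y) (c t ∘ₗ LinearMap.fst ℝ Z Y))
  have hN : sigPos (N t) = sigPos (N t') := by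
    refine sigPos_eq_of_continuousOn hS ?_ ?_ ht ht'
    · rintro ⟨z, y⟩
      simp only [N, LinearMap.BilinMap.toQuadraticMap_apply, LinearMap.sub_apply,
        LinearMap.smul_apply, LinearMap.compl₁₂_apply, LinearMap.comp_apply, LinearMap.fst_apply,
        LinearMap.snd_apply, smul_eq_mul]
      exact (((hcont₂ z y).const_mul 2).sub continuousOn_const).sub (hcont₁ z)
    · intro r hr
      rw [Submodule.eq_bot_iff]
      rintro ⟨z, y⟩ hz
      rw [mem_radical_iff_polar] at hz
      have hpol : ∀ z' y', QuadraticMap.polar (N r) (z, y) (z', y')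
          = 2 * p (a r z') (y - c r z) + 2 * p (a r z - B y) y' := by
        intro z' y'
        have h1 := hac r hr z z'
        have h2 := hB y y'
        simp only [N, LinearMap.BilinMap.polar_toQuadraticMap, LinearMap.sub_apply,
          LinearMap.smul_apply, LinearMap.compl₁₂_apply, LinearMap.comp_apply,
          LinearMap.fst_apply, LinearMap.snd_apply, smul_eq_mul, map_sub]
        linarith
      have hy : y - c r z = 0 := by
        refine hpY _ fun x => ?_
        obtain ⟨z', rfl⟩ := (ha r hr).2 x
        have := hz (z', 0)
        rw [hpol, map_zero] at this
        linarith
      have hx : a r z - B y = 0 := by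
        refine hpX _ fun y' => ?_
        have := hz (0, y')
        rw [hpol, map_zero, map_zero] at this
        simp only [LinearMap.zero_apply] at this
        linarith
      have hz0 : z = 0 := by
        refine haB r hr ?_
        rw [map_zero, LinearMap.sub_apply, LinearMap.comp_apply, ← sub_eq_zero.1 hy, hx]
      rw [hz0, map_zero, sub_zero] at hy
      rw [hz0, hy]
      rfl
  have key : ∀ r ∈ S,
      sigPos (LinearMap.BilinMap.toQuadraticMap (p.compl₁₂ (a r - B ∘ₗ c r) (c r))) + sigPos K
      = sigPos (LinearMap.BilinMap.toQuadraticMap (p.compl₁₂ (a r) (c r))) + sigPos (N r) := by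
    intro r hr
    let α : Z ≃ₗ[ℝ] X := LinearEquiv.ofBijective (a r) (ha r hr)
    have hα : ∀ z, α z = a r z := fun z => rfl
    -- Both sides are the index of `p (a z) (c z) + 2 p x (c z) + 2 p x y - p (B y) y`.
    let e₁ : (Z × X × Y) ≃ₗ[ℝ] Z × X × Y :=
      LinearEquiv.ofLinearMap
        ((LinearMap.fst ℝ Z (X × Y)).prod
          (LinearMap.snd ℝ Z (X × Y) + ((B ∘ₗ c r).prod (c r)) ∘ₗ LinearMap.fst ℝ Z (X × Y)))
        ((LinearMap.fst ℝ Z (X × Y)).prod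
          (LinearMap.snd ℝ Z (X × Y) - ((B ∘ₗ c r).prod (c r)) ∘ₗ LinearMap.fst ℝ Z (X × Y)))
        (by ext <;> simp) (by ext <;> simp)
    let β : (Z × X × Y) →ₗ[ℝ] Z :=
      α.symm.toLinearMap ∘ₗ LinearMap.fst ℝ X Y ∘ₗ LinearMap.snd ℝ Z (X × Y)
    let e₂ : (Z × X × Y) ≃ₗ[ℝ] Z × Z × Y :=
      LinearEquiv.ofLinearMap
        ((LinearMap.fst ℝ Z (X × Y) + β).prod
          (β.prod (LinearMap.snd ℝ X Y ∘ₗ LinearMap.snd ℝ Z (X × Y))))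
        ((LinearMap.fst ℝ Z (Z × Y) - LinearMap.fst ℝ Z Y ∘ₗ LinearMap.snd ℝ Z (Z × Y)).prod
          ((α.toLinearMap.prodMap LinearMap.id) ∘ₗ LinearMap.snd ℝ Z (Z × Y)))
        (by ext <;> simp [β]) (by ext <;> simp [β])
    rw [← sigPos_prod, ← sigPos_prod, ← sigPos_comp_equiv _ e₁, ← sigPos_comp_equiv _ e₂]
    congr 1
    ext ⟨z, x, y⟩
    obtain ⟨u, rfl⟩ := α.surjective x
    have h1 := hac r hr z u
    have h2 := hB y (c r z)
    have h3 : α.symm (a r u) = u := α.symm_apply_apply u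
    simp only [K, N, e₁, e₂, β, QuadraticMap.comp_apply, LinearEquiv.coe_coe,
      LinearEquiv.coe_ofLinearMap, LinearMap.prod_apply, Function.prod_apply, LinearMap.add_apply,
      LinearMap.comp_apply, LinearMap.fst_apply, LinearMap.snd_apply, QuadraticMap.prod_apply,
      LinearMap.BilinMap.toQuadraticMap_apply, LinearMap.sub_apply, LinearMap.smul_apply,
      LinearMap.compl₁₂_apply, smul_eq_mul, map_sub, map_add, hα, h3]
    linarith
  have k1 := key t ht
  have k2 := key t' ht'
  omega

section Path

variable {V Z : Type*} [NormedAddCommGroup V] [NormedSpace ℝ V] [FiniteDimensional ℝ V]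
  [AddCommGroup Z] [Module ℝ Z] [FiniteDimensional ℝ Z]
  {Ω : LinearMap.BilinForm ℝ V} {L₀ M M' : Submodule ℝ V} {Φ : ℝ → Z →ₗ[ℝ] V}

omit [FiniteDimensional ℝ V] in
theorem IsLagrangian.apply_eq_zero {L : Submodule ℝ V} (hL : IsLagrangian Ω L) {x y : V}
    (hx : x ∈ L) (hy : y ∈ L) : Ω x y = 0 := by
  rw [← hL] at hy
  exact hy x hx

omit [FiniteDimensional ℝ V] in
theorem IsLagrangian.mem_of_forall {L : Submodule ℝ V} (hL : IsLagrangian Ω L) {y : V}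
    (h : ∀ x ∈ L, Ω x y = 0) : y ∈ L := by
  rw [← hL]
  exact h

/-- The difference of the positive indices of a path of Lagrangian subspaces in two charts centred
at `L₀` is constant as long as the path stays in both of them. -/
theorem chartCoindex_add_eq_of_path (hskew : ∀ x y, Ω x y = -Ω y x) (hL₀ : IsLagrangian Ω L₀)
    (hM : IsLagrangian Ω M) (hM' : IsLagrangian Ω M') (hML₀ : IsCompl M L₀)
    (hM'L₀ : IsCompl M' L₀) {S : Set ℝ} (hS : IsPreconnected S)
    (hcont : ∀ z, ContinuousOn (fun t => Φ t z) S)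
    (hinj : ∀ t ∈ S, Function.Injective (Φ t))
    (hiso : ∀ t ∈ S, ∀ z z', Ω (Φ t z) (Φ t z') = 0)
    (hMΦ : ∀ t ∈ S, IsCompl M (LinearMap.range (Φ t)))
    (hM'Φ : ∀ t ∈ S, IsCompl M' (LinearMap.range (Φ t))) {t t' : ℝ} (ht : t ∈ S) (ht' : t' ∈ S) :
    chartCoindex Ω L₀ M' (LinearMap.range (Φ t)) + chartCoindex Ω L₀ M (LinearMap.range (Φ t'))
      = chartCoindex Ω L₀ M' (LinearMap.range (Φ t'))
        + chartCoindex Ω L₀ M (LinearMap.range (Φ t)) := by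
  let π : V →ₗ[ℝ] L₀ := L₀.projectionOnto M hML₀.symm
  let κ : V →ₗ[ℝ] M := M.projectionOnto L₀ hML₀
  let π' : V →ₗ[ℝ] L₀ := L₀.projectionOnto M' hM'L₀.symm
  have hπκ : ∀ x, (π x : V) + κ x = x := fun x =>
    Submodule.projection_add_projection_eq_self hML₀.symm x
  have hπ' : ∀ x, x - π' x ∈ M' := by
    intro x
    rw [← Submodule.projectionOnto_apply_eq_zero_iff hM'L₀.symm, map_sub,
      Submodule.projectionOnto_apply_left]
    exact sub_self _
  have hπ'L₀ : ∀ x : L₀, π' x = x := fun x => Submodule.projectionOnto_apply_left _ x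
  let B : M →ₗ[ℝ] L₀ := -(π' ∘ₗ M.subtype)
  let p : L₀ →ₗ[ℝ] M →ₗ[ℝ] ℝ := Ω.compl₁₂ L₀.subtype M.subtype
  have hp : ∀ x y, p x y = Ω x y := fun _ _ => rfl
  have hBM' : ∀ y : M, (y : V) + B y ∈ M' := by
    intro y
    have := hπ' y
    simpa [B, sub_eq_add_neg] using this
  have hdim : ∀ t ∈ S, Module.finrank ℝ Z = Module.finrank ℝ L₀ := by
    intro r hr
    have h1 := Submodule.finrank_add_eq_of_isCompl hML₀
    have h2 := Submodule.finrank_add_eq_of_isCompl (hMΦ r hr)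
    rw [LinearMap.finrank_range_of_inj (hinj r hr)] at h2
    omega
  have hΦ : ∀ r z, π' (Φ r z) = π (Φ r z) - B (κ (Φ r z)) := by
    intro r z
    conv_lhs => rw [← hπκ (Φ r z), map_add, hπ'L₀]
    simp [B]
  -- The chart forms of both charts, on the parameter space.
  have hchart : ∀ r ∈ S, chartCoindex Ω L₀ M (LinearMap.range (Φ r))
      = sigPos (LinearMap.BilinMap.toQuadraticMap (p.compl₁₂ (π ∘ₗ Φ r) (κ ∘ₗ Φ r))) := by
    intro r hr
    have hsum : L₀.subtype ∘ₗ π ∘ₗ Φ r + M.subtype ∘ₗ κ ∘ₗ Φ r = Φ r := by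
      ext z
      exact hπκ _
    have := chartCoindex_eq_sigPos Ω (L₀ := L₀) (M := M) (L₀.subtype ∘ₗ π ∘ₗ Φ r)
      (M.subtype ∘ₗ κ ∘ₗ Φ r) (fun z => (π (Φ r z)).2) (fun z => (κ (Φ r z)).2)
      (by rw [hsum]; exact hinj r hr) (by rw [hsum]; exact hMΦ r hr) (hdim r hr)
    rw [hsum] at this
    exact this
  have hchart' : ∀ r ∈ S, chartCoindex Ω L₀ M' (LinearMap.range (Φ r))
      = sigPos (LinearMap.BilinMap.toQuadraticMap
          (p.compl₁₂ (π ∘ₗ Φ r - B ∘ₗ κ ∘ₗ Φ r) (κ ∘ₗ Φ r))) := by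
    intro r hr
    have hsum : L₀.subtype ∘ₗ π' ∘ₗ Φ r + (Φ r - L₀.subtype ∘ₗ π' ∘ₗ Φ r) = Φ r :=
      add_sub_cancel _ _
    have := chartCoindex_eq_sigPos Ω (L₀ := L₀) (M := M') (L₀.subtype ∘ₗ π' ∘ₗ Φ r)
      (Φ r - L₀.subtype ∘ₗ π' ∘ₗ Φ r) (fun z => (π' (Φ r z)).2) (fun z => hπ' _)
      (by rw [hsum]; exact hinj r hr) (by rw [hsum]; exact hM'Φ r hr) (hdim r hr)
    rw [hsum] at this
    rw [this]
    congr 1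
    ext z
    have h1 : Φ r z - π' (Φ r z) = κ (Φ r z) + B (κ (Φ r z)) := by
      rw [hΦ, sub_eq_iff_eq_add, Submodule.coe_sub, ← hπκ (Φ r z), hπκ]
      rw [← sub_eq_zero]
      nth_rewrite 1 [← hπκ (Φ r z)]
      abel
    have h2 : Ω (π' (Φ r z)) (B (κ (Φ r z))) = 0 := hL₀.apply_eq_zero (π' _).2 (B _).2
    change Ω (π' (Φ r z)) (Φ r z - π' (Φ r z)) = p (π (Φ r z) - B (κ (Φ r z))) (κ (Φ r z))
    rw [h1, map_add, h2, add_zero, ← hΦ, hp]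
  have hcontV : ∀ f g : V →ₗ[ℝ] V, ∀ z,
      ContinuousOn (fun r => Ω (f (Φ r z)) (g (Φ r z))) S := by
    intro f g z
    have h1 : Continuous fun x : V => Ω (f x) (g x) := by
      change Continuous fun x : V => (Ω.compl₁₂ f g).toContinuousBilinearMap x x
      fun_prop
    exact h1.comp_continuousOn (hcont z)
  rw [hchart t ht, hchart t' ht', hchart' t ht, hchart' t' ht']
  refine sigPos_change_of_chart p B ?_ ?_ ?_ hS (fun r => π ∘ₗ Φ r) (fun r => κ ∘ₗ Φ r) ?_ ?_ ?_
    ?_ ?_ ht ht'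
  · intro y y'
    have h1 := hM'.apply_eq_zero (hBM' y) (hBM' y')
    have h2 : Ω y y' = 0 := hM.apply_eq_zero y.2 y'.2
    have h3 : Ω (B y) (B y') = 0 := hL₀.apply_eq_zero (B y).2 (B y').2
    have h4 := hskew y (B y')
    simp only [map_add, LinearMap.add_apply] at h1
    rw [hp, hp]
    linarith
  · intro x hx
    have : (x : V) ∈ M := hM.mem_of_forall fun y hy => by
      rw [hskew, neg_eq_zero]
      exact hx ⟨y, hy⟩
    exact Subtype.ext ((Submodule.disjoint_def.1 hML₀.disjoint) _ this x.2)
  · intro y hy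
    have : (y : V) ∈ L₀ := hL₀.mem_of_forall fun x hx => hy ⟨x, hx⟩
    exact Subtype.ext ((Submodule.disjoint_def.1 hML₀.disjoint) _ y.2 this)
  · intro r hr z z'
    have h1 := hiso r hr z z'
    rw [← hπκ (Φ r z), ← hπκ (Φ r z')] at h1
    have h2 : Ω (π (Φ r z)) (π (Φ r z')) = 0 := hL₀.apply_eq_zero (π _).2 (π _).2
    have h3 : Ω (κ (Φ r z)) (κ (Φ r z')) = 0 := hM.apply_eq_zero (κ _).2 (κ _).2
    have h4 := hskew (κ (Φ r z)) (π (Φ r z'))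
    simp only [map_add, LinearMap.add_apply] at h1
    change Ω (π (Φ r z)) (κ (Φ r z')) = Ω (π (Φ r z')) (κ (Φ r z))
    linarith
  · intro r hr
    have : Function.Injective (π ∘ₗ Φ r) := by
      rw [← LinearMap.ker_eq_bot, LinearMap.ker_eq_bot']
      intro z hz
      have h1 : Φ r z ∈ M := (Submodule.projectionOnto_apply_eq_zero_iff hML₀.symm).1 hz
      have h2 := (Submodule.disjoint_def.1 (hMΦ r hr).disjoint) _ h1 ⟨z, rfl⟩
      exact hinj r hr (by rw [h2, map_zero])
    exact ⟨this, (LinearMap.injective_iff_surjective_of_finrank_eq_finrank (hdim r hr)).1 this⟩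
  · intro r hr
    rw [← LinearMap.ker_eq_bot, LinearMap.ker_eq_bot']
    intro z hz
    have h0 : π' (Φ r z) = 0 := by rw [hΦ]; exact hz
    have h1 : Φ r z ∈ M' := (Submodule.projectionOnto_apply_eq_zero_iff hM'L₀.symm).1 h0
    have h2 := (Submodule.disjoint_def.1 (hM'Φ r hr).disjoint) _ h1 ⟨z, rfl⟩
    exact hinj r hr (by rw [h2, map_zero])
  · exact fun z => hcontV (L₀.subtype ∘ₗ π) (M.subtype ∘ₗ κ) z
  · intro z y
    have h1 : Continuous fun x : V => Ω (π x) y :=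
      LinearMap.continuous_of_finiteDimensional ((Ω.flip y) ∘ₗ L₀.subtype ∘ₗ π)
    exact h1.comp_continuousOn (hcont z)

/-- If a path of Lagrangian subspaces stays in a single chart centred at `L₀` then its intersection
number with the Maslov cycle of `L₀`, computed from any subdivision and any charts, is the increment
of the positive index in that chart. -/
theorem IsIntersectionNumber.eq_chartCoindex_sub (hskew : ∀ x y, Ω x y = -Ω y x)
    (hL₀ : IsLagrangian Ω L₀) (hM : IsLagrangian Ω M) (hML₀ : IsCompl M L₀) {a b : ℝ}
    (hcont : ∀ z, ContinuousOn (fun t => Φ t z) (Icc a b))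
    (hinj : ∀ t ∈ Icc a b, Function.Injective (Φ t))
    (hiso : ∀ t ∈ Icc a b, ∀ z z', Ω (Φ t z) (Φ t z') = 0)
    (hMΦ : ∀ t ∈ Icc a b, IsCompl M (LinearMap.range (Φ t))) {k : ℤ}
    (hk : IsIntersectionNumber Ω L₀ (fun t => LinearMap.range (Φ t)) a b k) :
    k = (chartCoindex Ω L₀ M (LinearMap.range (Φ b)) : ℤ)
      - chartCoindex Ω L₀ M (LinearMap.range (Φ a)) := by
  obtain ⟨-, -, N, τ, M', hτ, rfl, rfl, hM', rfl⟩ := hk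
  have hstep : ∀ i : Fin N,
      (chartCoindex Ω L₀ (M' i) (LinearMap.range (Φ (τ i.succ))) : ℤ)
        - chartCoindex Ω L₀ (M' i) (LinearMap.range (Φ (τ i.castSucc)))
      = chartCoindex Ω L₀ M (LinearMap.range (Φ (τ i.succ)))
        - chartCoindex Ω L₀ M (LinearMap.range (Φ (τ i.castSucc))) := by
    intro i
    obtain ⟨h1, h2, h3⟩ := hM' i
    have hle : τ i.castSucc ≤ τ i.succ := hτ (Fin.castSucc_le_succ i)
    have hsub : Icc (τ i.castSucc) (τ i.succ) ⊆ Icc (τ 0) (τ (Fin.last N)) :=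
      Icc_subset_Icc (hτ (Fin.zero_le _)) (hτ (Fin.le_last _))
    have := chartCoindex_add_eq_of_path hskew hL₀ hM h1 hML₀ h2 isPreconnected_Icc
      (fun z => (hcont z).mono hsub) (fun t ht => hinj t (hsub ht)) (fun t ht => hiso t (hsub ht))
      (fun t ht => hMΦ t (hsub ht)) h3 (right_mem_Icc.2 hle) (left_mem_Icc.2 hle)
    omega
  rw [Finset.sum_congr rfl fun i _ => hstep i]
  have htel : ∀ (m : ℕ) (f : Fin (m + 1) → ℤ),
      ∑ i : Fin m, (f i.succ - f i.castSucc) = f (Fin.last m) - f 0 := by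
    intro m
    induction m with
    | zero => intro f; simp
    | succ m ih =>
      intro f
      rw [Fin.sum_univ_castSucc]
      have := ih fun i => f i.castSucc
      simp only [Fin.succ_castSucc, Fin.succ_last, Fin.castSucc_zero] at this ⊢
      rw [this]
      ring
  exact htel N fun i => (chartCoindex Ω L₀ M (LinearMap.range (Φ (τ i))) : ℤ)

omit [FiniteDimensional ℝ V] [FiniteDimensional ℝ Z] in
/-- A path in a single chart whose endpoints are transverse to `L₀` has an intersection number. -/
theorem isIntersectionNumber_of_chart {ℓ : ℝ → Submodule ℝ V}
    (hM : IsLagrangian Ω M) (hML₀ : IsCompl M L₀) {a b : ℝ} (hab : a ≤ b)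
    (hMℓ : ∀ t ∈ Icc a b, IsCompl M (ℓ t)) (ha : ℓ a ⊓ L₀ = ⊥) (hb : ℓ b ⊓ L₀ = ⊥) :
    IsIntersectionNumber Ω L₀ ℓ a b
      ((chartCoindex Ω L₀ M (ℓ b) : ℤ) - chartCoindex Ω L₀ M (ℓ a)) := by
  refine ⟨ha, hb, 1, ![a, b], fun _ => M, ?_, rfl, rfl, ?_, ?_⟩
  · rw [Fin.monotone_iff_le_succ]
    intro i
    fin_cases i
    exact hab
  · intro i
    fin_cases i
    exact ⟨hM, hML₀, hMℓ⟩
  · simp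

end Path

end Charts

/-! ### Solutions of the Hamiltonian system -/

section Solutions

variable {n : ℕ}

theorem hasDerivWithinAt_dotProduct {u v : ℝ → Fin n → ℝ} {u' v' : Fin n → ℝ} {S : Set ℝ} {t : ℝ}
    (hu : HasDerivWithinAt u u' S t) (hv : HasDerivWithinAt v v' S t) :
    HasDerivWithinAt (fun r => u r ⬝ᵥ v r) (u' ⬝ᵥ v t + u t ⬝ᵥ v') S t := by
  rw [hasDerivWithinAt_pi] at hu hv
  have := HasDerivWithinAt.fun_sum (u := Finset.univ) fun i _ => (hu i).mul (hv i)
  simpa [dotProduct, Finset.sum_add_distrib] using this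

theorem hasDerivWithinAt_mulVec {m : Type*} [Fintype m] {N : ℝ → Matrix m m ℝ} {N' : Matrix m m ℝ}
    {v : ℝ → m → ℝ} {v' : m → ℝ} {S : Set ℝ} {t : ℝ}
    (hN : ∀ i j, HasDerivWithinAt (fun r => N r i j) (N' i j) S t)
    (hv : HasDerivWithinAt v v' S t) :
    HasDerivWithinAt (fun r => N r *ᵥ v r) (N' *ᵥ v t + N t *ᵥ v') S t := by
  rw [hasDerivWithinAt_pi] at hv ⊢
  intro i
  have := HasDerivWithinAt.fun_sum (u := Finset.univ) fun j _ => (hN i j).mul (hv j)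
  simpa [Matrix.mulVec, dotProduct, Finset.sum_add_distrib] using this

/-- `t ↦ (y t, x t)` solves `y' = s P x`, `x' = P⁻¹ y` on `[0, T]`, which is the Hamiltonian system
`z' = J B_{0,s} z` for `z = (y, x)`. -/
def IsSolution (P : ℝ → Matrix (Fin n) (Fin n) ℝ) (s T : ℝ) (y x : ℝ → Fin n → ℝ) : Prop :=
  ∀ t ∈ Icc 0 T, HasDerivWithinAt y (s • P t *ᵥ x t) (Icc 0 T) t ∧
    HasDerivWithinAt x ((P t)⁻¹ *ᵥ y t) (Icc 0 T) t

theorem IsFundamentalSolution.isSolution {P : ℝ → Matrix (Fin n) (Fin n) ℝ} {s T : ℝ}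
    {ψ : ℝ → Matrix (Fin n ⊕ Fin n) (Fin n ⊕ Fin n) ℝ}
    (hψ : IsFundamentalSolution (hamB P s) T ψ) (z : PhaseSpace n) :
    IsSolution P s T (fun t => (ψ t *ᵥ z) ∘ Sum.inl) (fun t => (ψ t *ᵥ z) ∘ Sum.inr) := by
  intro t ht
  have h := hasDerivWithinAt_mulVec (hψ.2 t ht) (hasDerivWithinAt_const t (Icc 0 T) z)
  have e : (Matrix.J (Fin n) ℝ * hamB P s t * ψ t) *ᵥ z + ψ t *ᵥ 0
      = Sum.elim (s • P t *ᵥ ((ψ t *ᵥ z) ∘ Sum.inr)) ((P t)⁻¹ *ᵥ ((ψ t *ᵥ z) ∘ Sum.inl)) := by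
    rw [Matrix.mulVec_zero, add_zero, ← Matrix.mulVec_mulVec, Matrix.J, hamB,
      Matrix.fromBlocks_multiply, Matrix.fromBlocks_mulVec]
    simp [Matrix.smul_mulVec]
  rw [e, hasDerivWithinAt_pi] at h
  exact ⟨hasDerivWithinAt_pi.2 fun i => h (Sum.inl i), hasDerivWithinAt_pi.2 fun i => h (Sum.inr i)⟩

theorem IsFundamentalSolution.continuousOn {P : ℝ → Matrix (Fin n) (Fin n) ℝ} {s T : ℝ}
    {ψ : ℝ → Matrix (Fin n ⊕ Fin n) (Fin n ⊕ Fin n) ℝ}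
    (hψ : IsFundamentalSolution (hamB P s) T ψ) : ContinuousOn ψ (Icc 0 T) :=
  continuousOn_pi.2 fun i => continuousOn_pi.2 fun j => fun t ht =>
    (hψ.2 t ht i j).continuousWithinAt

/-- The flow of a Hamiltonian system with symmetric coefficients preserves `ω`. -/
theorem IsSolution.wronskian_eq {P : ℝ → Matrix (Fin n) (Fin n) ℝ} {s T : ℝ}
    (hP : ∀ t ∈ Icc 0 T, (P t).IsSymm) {y x y' x' : ℝ → Fin n → ℝ} (h : IsSolution P s T y x)
    (h' : IsSolution P s T y' x') {t : ℝ} (ht : t ∈ Icc 0 T) :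
    y t ⬝ᵥ x' t - x t ⬝ᵥ y' t = y 0 ⬝ᵥ x' 0 - x 0 ⬝ᵥ y' 0 := by
  have hd : ∀ r ∈ Icc 0 T,
      HasDerivWithinAt (fun r => y r ⬝ᵥ x' r - x r ⬝ᵥ y' r) 0 (Icc 0 T) r := by
    intro r hr
    have := (hasDerivWithinAt_dotProduct (h r hr).1 (h' r hr).2).sub
      (hasDerivWithinAt_dotProduct (h r hr).2 (h' r hr).1)
    refine this.congr_deriv ?_
    have e1 : y r ⬝ᵥ ((P r)⁻¹ *ᵥ y' r) = ((P r)⁻¹ *ᵥ y r) ⬝ᵥ y' r := by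
      rw [Matrix.dotProduct_mulVec, ← Matrix.mulVec_transpose, (hP r hr).inv.eq]
    have e2 : (s • P r *ᵥ x r) ⬝ᵥ x' r = x r ⬝ᵥ (s • P r *ᵥ x' r) := by
      rw [smul_dotProduct, dotProduct_smul, Matrix.dotProduct_mulVec, ← Matrix.mulVec_transpose,
        (hP r hr).eq]
    rw [e1, e2]
    ring
  exact constant_of_has_deriv_right_zero (fun r hr => (hd r hr).continuousWithinAt)
    (fun r hr => ((hd r (Ico_subset_Icc_self hr)).mono_of_mem_nhdsWithin
      (Icc_mem_nhdsGE_of_mem hr))) t ht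

/-- For a `C¹` path of invertible matrices, the inverse path has a derivative `R'` such
that the entries of `R' P` are bounded. -/
theorem exists_deriv_inv_bound {T : ℝ} (hT : 0 < T) {P : ℝ → Matrix (Fin n) (Fin n) ℝ}
    (hP_smooth : ∀ i j, ContDiffOn ℝ 1 (fun t => P t i j) (Icc 0 T))
    (hP_nondeg : ∀ t ∈ Icc 0 T, IsUnit (P t).det) :
    ∃ (R' : ℝ → Matrix (Fin n) (Fin n) ℝ) (C : ℝ), 0 ≤ C ∧ ∀ t ∈ Icc 0 T, ∀ i j,
      HasDerivWithinAt (fun r => (P r)⁻¹ i j) (R' t i j) (Icc 0 T) t ∧ |(R' t * P t) i j| ≤ C := by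
  have hdet : ∀ N : ℝ → Matrix (Fin n) (Fin n) ℝ,
      (∀ i j, ContDiffOn ℝ 1 (fun t => N t i j) (Icc 0 T)) →
      ContDiffOn ℝ 1 (fun t => (N t).det) (Icc 0 T) := by
    intro N hN
    simp only [Matrix.det_apply]
    exact ContDiffOn.sum fun τ _ => (contDiffOn_prod fun i _ => hN _ _).const_smul _
  have hinv : ∀ i j, ContDiffOn ℝ 1 (fun t => (P t)⁻¹ i j) (Icc 0 T) := by
    intro i j
    simp only [Matrix.inv_def, Ring.inverse_eq_inv', Matrix.smul_apply, smul_eq_mul,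
      Matrix.adjugate_apply]
    refine ContDiffOn.mul ((hdet P hP_smooth).inv fun t ht => (hP_nondeg t ht).ne_zero) ?_
    refine hdet _ fun k l => ?_
    by_cases hk : k = j
    · simp only [hk, Matrix.updateRow_self]
      exact contDiffOn_const
    · simp only [Matrix.updateRow_ne hk]
      exact hP_smooth k l
  have hu : UniqueDiffOn ℝ (Icc 0 T) := uniqueDiffOn_Icc hT
  let R' : ℝ → Matrix (Fin n) (Fin n) ℝ := fun t =>
    Matrix.of fun i j => derivWithin (fun r => (P r)⁻¹ i j) (Icc 0 T) t
  have hcont : ∀ i j, ContinuousOn (fun t => (R' t * P t) i j) (Icc 0 T) := by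
    intro i j
    simp only [Matrix.mul_apply]
    exact continuousOn_finsetSum _ fun k _ =>
      ((hinv i k).continuousOn_derivWithin hu le_rfl).mul (hP_smooth k j).continuousOn
  choose C hC using fun i j => isCompact_Icc.exists_bound_of_continuousOn (hcont i j)
  refine ⟨R', ∑ i, ∑ j, |C i j|, by positivity, fun t ht i j => ⟨?_, ?_⟩⟩
  · exact ((hinv i j).differentiableOn one_ne_zero t ht).hasDerivWithinAt
  · calc |(R' t * P t) i j| ≤ |C i j| := (hC i j t ht).trans (le_abs_self _)
      _ ≤ ∑ j, |C i j| :=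
        Finset.single_le_sum (f := fun j => |C i j|) (fun _ _ => abs_nonneg _) (Finset.mem_univ j)
      _ ≤ ∑ i, ∑ j, |C i j| :=
        Finset.single_le_sum (f := fun i => ∑ j, |C i j|)
          (fun _ _ => Finset.sum_nonneg fun _ _ => abs_nonneg _) (Finset.mem_univ i)

/-- A weighted Young inequality for a bilinear form with bounded entries, with the weight chosen so
that half of `|v|²` is left to spare. -/
theorem abs_dotProduct_mulVec_le {K : Matrix (Fin n) (Fin n) ℝ} {C D : ℝ}
    (hK : ∀ i j, |K i j| ≤ C) (hD : 0 < D) (hCD : n * C ≤ D) (x v : Fin n → ℝ) :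
    |x ⬝ᵥ (K *ᵥ v)| ≤ (D ^ 2 * (x ⬝ᵥ x) + v ⬝ᵥ v) / 2 := by
  have hterm : ∀ i j, |x i * (K i j * v j)| ≤ C * ((D * (x i * x i) + D⁻¹ * (v j * v j)) / 2) := by
    intro i j
    have h1 : |x i| * |v j| ≤ (D * (x i * x i) + D⁻¹ * (v j * v j)) / 2 := by
      have h2 : D * |x i| * (D * |x i|) + |v j| * |v j| ≥ 2 * (D * |x i|) * |v j| := by
        nlinarith [sq_nonneg (D * |x i| - |v j|)]
      rw [← abs_mul_abs_self (x i), ← abs_mul_abs_self (v j)]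
      have h3 : D * (|x i| * |x i|) + D⁻¹ * (|v j| * |v j|)
          = D⁻¹ * (D * |x i| * (D * |x i|) + |v j| * |v j|) := by
        field_simp
      have h4 : |x i| * |v j| = D⁻¹ * (2 * (D * |x i|) * |v j|) / 2 := by
        field_simp
      rw [h3, h4]
      gcongr
    calc |x i * (K i j * v j)| = |K i j| * (|x i| * |v j|) := by
          rw [abs_mul, abs_mul]; ring
      _ ≤ C * ((D * (x i * x i) + D⁻¹ * (v j * v j)) / 2) :=
          mul_le_mul (hK i j) h1 (by positivity) ((abs_nonneg _).trans (hK i j))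
  have hx : 0 ≤ x ⬝ᵥ x := Finset.sum_nonneg fun i _ => mul_self_nonneg _
  have hv : 0 ≤ v ⬝ᵥ v := Finset.sum_nonneg fun i _ => mul_self_nonneg _
  calc |x ⬝ᵥ (K *ᵥ v)| = |∑ i, ∑ j, x i * (K i j * v j)| := by
        simp only [dotProduct, Matrix.mulVec, Finset.mul_sum]
    _ ≤ ∑ i, ∑ j, |x i * (K i j * v j)| :=
        (Finset.abs_sum_le_sum_abs _ _).trans
          (Finset.sum_le_sum fun i _ => Finset.abs_sum_le_sum_abs _ _)
    _ ≤ ∑ i, ∑ j, C * ((D * (x i * x i) + D⁻¹ * (v j * v j)) / 2) :=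
        Finset.sum_le_sum fun i _ => Finset.sum_le_sum fun j _ => hterm i j
    _ = n * C * ((D * (x ⬝ᵥ x) + D⁻¹ * (v ⬝ᵥ v)) / 2) := by
        have h : ∀ i, ∑ j, C * ((D * (x i * x i) + D⁻¹ * (v j * v j)) / 2)
            = C * D * n / 2 * (x i * x i) + C * D⁻¹ / 2 * (v ⬝ᵥ v) := by
          intro i
          simp only [add_div, mul_add, Finset.sum_add_distrib, Finset.sum_const, Finset.card_univ,
            Fintype.card_fin, nsmul_eq_mul, dotProduct, Finset.mul_sum]
          congr 1
          · ring
          · exact Finset.sum_congr rfl fun j _ => by ring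
        rw [Finset.sum_congr rfl fun i _ => h i, Finset.sum_add_distrib, ← Finset.mul_sum,
          Finset.sum_const, Finset.card_univ, Fintype.card_fin, nsmul_eq_mul]
        simp only [dotProduct]
        ring
    _ ≤ D * ((D * (x ⬝ᵥ x) + D⁻¹ * (v ⬝ᵥ v)) / 2) := by gcongr
    _ = (D ^ 2 * (x ⬝ᵥ x) + v ⬝ᵥ v) / 2 := by field_simp

/-- For large `s` the function `⟨x, P⁻¹ y⟩ = ⟨x, x'⟩` is strictly increasing along nonzero
solutions: its derivative is `|x'|² + s |x|²` up to a term of size `O(|x| |x'|)`. No definiteness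
of `P` is needed. -/
theorem exists_threshold {T : ℝ} (hT : 0 < T) {P : ℝ → Matrix (Fin n) (Fin n) ℝ}
    (hP_smooth : ∀ i j, ContDiffOn ℝ 1 (fun t => P t i j) (Icc 0 T))
    (hP_nondeg : ∀ t ∈ Icc 0 T, IsUnit (P t).det) :
    ∃ σ : ℝ, 0 ≤ σ ∧ ∀ s, σ ≤ s → ∀ y x, IsSolution P s T y x → ∀ t ∈ Ioc 0 T,
      x 0 ⬝ᵥ ((P 0)⁻¹ *ᵥ y 0) = x t ⬝ᵥ ((P t)⁻¹ *ᵥ y t) → y 0 = 0 ∧ x 0 = 0 := by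
  obtain ⟨R', C, hC, hR⟩ := exists_deriv_inv_bound hT hP_smooth hP_nondeg
  let D : ℝ := n * C + 1
  have hD : 0 < D := by positivity
  -- With `s ≥ D²` the derivative of `⟨x, P⁻¹ y⟩` is at least `(|x'|² + D² |x|²) / 2`.
  refine ⟨D ^ 2, by positivity, fun s hs y x h t ht heq => ?_⟩
  let g : ℝ → ℝ := fun r => x r ⬝ᵥ ((P r)⁻¹ *ᵥ y r)
  let g' : ℝ → ℝ := fun r => ((P r)⁻¹ *ᵥ y r) ⬝ᵥ ((P r)⁻¹ *ᵥ y r)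
    + x r ⬝ᵥ (R' r *ᵥ y r + (P r)⁻¹ *ᵥ (s • P r *ᵥ x r))
  have hg : ∀ r ∈ Icc 0 T, HasDerivWithinAt g (g' r) (Icc 0 T) r := fun r hr =>
    hasDerivWithinAt_dotProduct (h r hr).2
      (hasDerivWithinAt_mulVec (fun i j => (hR r hr i j).1) (h r hr).1)
  have hg' : ∀ r ∈ Icc 0 T,
      (((P r)⁻¹ *ᵥ y r) ⬝ᵥ ((P r)⁻¹ *ᵥ y r) + D ^ 2 * (x r ⬝ᵥ x r)) / 2 ≤ g' r := by
    intro r hr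
    have h1 : (P r)⁻¹ *ᵥ (s • P r *ᵥ x r) = s • x r := by
      rw [Matrix.mulVec_smul, Matrix.mulVec_mulVec, Matrix.nonsing_inv_mul _ (hP_nondeg r hr),
        Matrix.one_mulVec]
    have h2 : R' r *ᵥ y r = (R' r * P r) *ᵥ ((P r)⁻¹ *ᵥ y r) := by
      rw [Matrix.mulVec_mulVec, Matrix.mul_assoc, Matrix.mul_nonsing_inv _ (hP_nondeg r hr),
        Matrix.mul_one]
    have h3 := neg_le_of_abs_le (abs_dotProduct_mulVec_le (fun i j => (hR r hr i j).2) hD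
      (by simp [D]) (x r) ((P r)⁻¹ *ᵥ y r))
    have h4 : D ^ 2 * (x r ⬝ᵥ x r) ≤ s * (x r ⬝ᵥ x r) :=
      mul_le_mul_of_nonneg_right hs (Finset.sum_nonneg fun i _ => mul_self_nonneg _)
    simp only [g', h1]
    rw [dotProduct_add, dotProduct_smul, smul_eq_mul, h2]
    linarith
  have hnn : ∀ v : Fin n → ℝ, 0 ≤ v ⬝ᵥ v := fun v =>
    Finset.sum_nonneg fun i _ => mul_self_nonneg _
  have hsub : Icc 0 t ⊆ Icc 0 T := Icc_subset_Icc le_rfl ht.2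
  have hmono : MonotoneOn g (Icc 0 t) := by
    refine monotoneOn_of_hasDerivWithinAt_nonneg (f' := g') (convex_Icc 0 t)
      (fun r hr => ((hg r (hsub hr)).continuousWithinAt).mono hsub) (fun r hr => ?_)
      (fun r hr => ?_)
    · exact (hg r (hsub (interior_subset hr))).mono (interior_subset.trans hsub)
    · have := hg' r (hsub (interior_subset hr))
      have h1 := hnn ((P r)⁻¹ *ᵥ y r)
      have h2 := mul_nonneg (sq_nonneg D) (hnn (x r))
      linarith
  have h0 : (0 : ℝ) ∈ Icc 0 t := left_mem_Icc.2 ht.1.le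
  have hconst : ∀ r ∈ Icc 0 t, g r = g 0 := fun r hr =>
    le_antisymm ((hmono hr (right_mem_Icc.2 ht.1.le) hr.2).trans heq.ge) (hmono h0 hr hr.1)
  have hd0 : g' 0 = 0 := by
    have h1 : HasDerivWithinAt g 0 (Icc 0 t) 0 :=
      (hasDerivWithinAt_const (0 : ℝ) (Icc 0 t) (g 0)).congr hconst rfl
    exact (uniqueDiffOn_Icc ht.1 0 h0).eq_deriv _ ((hg 0 (hsub h0)).mono hsub) h1
  have h1 := hg' 0 (hsub h0)
  have h2 := hnn ((P 0)⁻¹ *ᵥ y 0)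
  have h3 := hnn (x 0)
  have h4 : 0 < D ^ 2 := by positivity
  have hx : x 0 = 0 := dotProduct_self_eq_zero.1 (by nlinarith)
  have hv : (P 0)⁻¹ *ᵥ y 0 = 0 := dotProduct_self_eq_zero.1 (by nlinarith)
  refine ⟨?_, hx⟩
  rw [← Matrix.one_mulVec (y 0), ← Matrix.mul_nonsing_inv _ (hP_nondeg 0 (hsub h0)),
    ← Matrix.mulVec_mulVec, hv, Matrix.mulVec_zero]

end Solutions

/-! ### The chart of `Gr(A_dᵀ)` whose complement is a product of coordinate planes -/

section Coordinates

variable {n : ℕ}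

theorem omega_eq (z z' : PhaseSpace n) :
    omega n z z' = (z ∘ Sum.inl) ⬝ᵥ (z' ∘ Sum.inr) - (z ∘ Sum.inr) ⬝ᵥ (z' ∘ Sum.inl) := by
  rw [omega_apply, Matrix.J, Matrix.fromBlocks_mulVec]
  simp only [dotProduct, Fintype.sum_sum_type, Sum.elim_inl, Sum.elim_inr, Matrix.zero_mulVec,
    Matrix.neg_mulVec, Matrix.one_mulVec, zero_add, add_zero, Pi.neg_apply, Function.comp_apply,
    neg_mul, Finset.sum_neg_distrib]
  ring

theorem graphForm_apply (u w : PhaseSpace n × PhaseSpace n) :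
    graphForm n u w = -omega n u.1 w.1 + omega n u.2 w.2 := rfl

theorem graphForm_skew (u w : PhaseSpace n × PhaseSpace n) :
    graphForm n u w = -graphForm n w u := by
  simp only [graphForm_apply, omega_eq, dotProduct_comm (w.1 ∘ _), dotProduct_comm (w.2 ∘ _)]
  ring

theorem diag₂_transpose_mulVec (A : Matrix (Fin n) (Fin n) ℝ) (z : PhaseSpace n) :
    (diag₂ A)ᵀ *ᵥ z = Sum.elim (Aᵀ *ᵥ (z ∘ Sum.inl)) (Aᵀ *ᵥ (z ∘ Sum.inr)) := by
  simp [diag₂, Matrix.fromBlocks_transpose, Matrix.fromBlocks_mulVec]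

theorem mem_Gr_diag₂_transpose {A : Matrix (Fin n) (Fin n) ℝ}
    {u : PhaseSpace n × PhaseSpace n} :
    u ∈ Gr (diag₂ A)ᵀ ↔ u.2 ∘ Sum.inl = Aᵀ *ᵥ (u.1 ∘ Sum.inl) ∧
      u.2 ∘ Sum.inr = Aᵀ *ᵥ (u.1 ∘ Sum.inr) := by
  rw [Gr, LinearMap.mem_graph_iff, Matrix.mulVecLin_apply, diag₂_transpose_mulVec]
  constructor
  · intro h
    rw [h]
    exact ⟨rfl, rfl⟩
  · rintro ⟨h1, h2⟩
    rw [← h1, ← h2, Sum.elim_comp_inl_inr]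

/-- The Lagrangian subspace `{x₁ = 0, y₂ = 0}` of `ℝ²ⁿ × ℝ²ⁿ`, with coordinates
`((y₁, x₁), (y₂, x₂))`: a Dirichlet condition on the first factor and a Neumann condition on the
second one. -/
def mixedPlane (n : ℕ) : Submodule ℝ (PhaseSpace n × PhaseSpace n) where
  carrier := {u | u.1 ∘ Sum.inr = 0 ∧ u.2 ∘ Sum.inl = 0}
  add_mem' := by
    rintro u w ⟨h1, h2⟩ ⟨h3, h4⟩
    exact ⟨by rw [Prod.fst_add, Pi.add_comp, h1, h3, add_zero],
      by rw [Prod.snd_add, Pi.add_comp, h2, h4, add_zero]⟩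
  zero_mem' := ⟨rfl, rfl⟩
  smul_mem' := by
    rintro c u ⟨h1, h2⟩
    exact ⟨by rw [Prod.smul_fst, Pi.smul_comp, h1, smul_zero],
      by rw [Prod.smul_snd, Pi.smul_comp, h2, smul_zero]⟩

theorem mem_mixedPlane {u : PhaseSpace n × PhaseSpace n} :
    u ∈ mixedPlane n ↔ u.1 ∘ Sum.inr = 0 ∧ u.2 ∘ Sum.inl = 0 := Iff.rfl

theorem isLagrangian_mixedPlane : IsLagrangian (graphForm n) (mixedPlane n) := by
  refine le_antisymm (fun u hu => ?_) fun u hu w hw => ?_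
  · rw [LinearMap.BilinForm.mem_orthogonal_iff] at hu
    refine ⟨dotProduct_self_eq_zero.1 ?_, dotProduct_self_eq_zero.1 ?_⟩
    · have := hu (Sum.elim (u.1 ∘ Sum.inr) 0, 0) ⟨rfl, rfl⟩
      simpa [graphForm_apply, omega_eq] using this
    · have := hu (0, Sum.elim 0 (u.2 ∘ Sum.inl)) ⟨rfl, rfl⟩
      simpa [graphForm_apply, omega_eq] using this
  · rw [mem_mixedPlane] at hu hw
    rw [graphForm_apply, omega_eq, omega_eq]
    simp [hu.1, hu.2, hw.1, hw.2]

theorem isLagrangian_Gr {A : Matrix (Fin n) (Fin n) ℝ}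
    (hA : A ∈ Matrix.orthogonalGroup (Fin n) ℝ) :
    IsLagrangian (graphForm n) (Gr (diag₂ A)ᵀ) := by
  have hAA : Aᵀ * A = 1 := (Matrix.mem_orthogonalGroup_iff' _ _).1 hA
  have hAA' : A * Aᵀ = 1 := (Matrix.mem_orthogonalGroup_iff _ _).1 hA
  have hdot : ∀ v w : Fin n → ℝ, (Aᵀ *ᵥ v) ⬝ᵥ w = v ⬝ᵥ (A *ᵥ w) := by
    intro v w
    rw [Matrix.dotProduct_mulVec, Matrix.mulVec_transpose]
  have hrec : ∀ v w : Fin n → ℝ, v = A *ᵥ w → w = Aᵀ *ᵥ v := by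
    rintro _ w rfl
    rw [Matrix.mulVec_mulVec, hAA, Matrix.one_mulVec]
  refine le_antisymm (fun u hu => ?_) fun u hu w hw => ?_
  · rw [LinearMap.BilinForm.mem_orthogonal_iff] at hu
    have key : ∀ η ξ : Fin n → ℝ, η ⬝ᵥ (A *ᵥ (u.2 ∘ Sum.inr) - u.1 ∘ Sum.inr)
        = ξ ⬝ᵥ (A *ᵥ (u.2 ∘ Sum.inl) - u.1 ∘ Sum.inl) := by
      intro η ξ
      have := hu (Sum.elim η ξ, (diag₂ A)ᵀ *ᵥ Sum.elim η ξ)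
        (mem_Gr_diag₂_transpose.2 (by simp [diag₂_transpose_mulVec]))
      rw [graphForm_apply, omega_eq, omega_eq,
        diag₂_transpose_mulVec] at this
      simp only [Sum.elim_comp_inl, Sum.elim_comp_inr, hdot] at this
      rw [dotProduct_sub, dotProduct_sub]
      linarith
    rw [mem_Gr_diag₂_transpose]
    constructor
    · refine hrec _ _ (sub_eq_zero.1 (dotProduct_self_eq_zero.1 ?_)).symm
      rw [← key 0, zero_dotProduct]
    · refine hrec _ _ (sub_eq_zero.1 (dotProduct_self_eq_zero.1 ?_)).symm
      rw [key _ 0, zero_dotProduct]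
  · rw [mem_Gr_diag₂_transpose] at hu hw
    rw [graphForm_apply, omega_eq, omega_eq, hu.1, hu.2, hw.1,
      hw.2]
    simp only [hdot, Matrix.mulVec_mulVec, hAA', Matrix.one_mulVec]
    ring

/-- The component in `Gr(A_dᵀ)` of a vector, along `mixedPlane`. -/
noncomputable def graphComponent (A : Matrix (Fin n) (Fin n) ℝ) :
    PhaseSpace n × PhaseSpace n →ₗ[ℝ] PhaseSpace n × PhaseSpace n where
  toFun u := (Sum.elim (A *ᵥ (u.2 ∘ Sum.inl)) (u.1 ∘ Sum.inr),
    Sum.elim (u.2 ∘ Sum.inl) (Aᵀ *ᵥ (u.1 ∘ Sum.inr)))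
  map_add' u w := by
    ext (i | i) <;> simp [Pi.add_comp, Matrix.mulVec_add]
  map_smul' c u := by
    ext (i | i) <;> simp [Pi.smul_comp, Matrix.mulVec_smul]

theorem graphComponent_mem {A : Matrix (Fin n) (Fin n) ℝ}
    (hA : A ∈ Matrix.orthogonalGroup (Fin n) ℝ) (u : PhaseSpace n × PhaseSpace n) :
    graphComponent A u ∈ Gr (diag₂ A)ᵀ := by
  have hAA : Aᵀ * A = 1 := (Matrix.mem_orthogonalGroup_iff' _ _).1 hA
  rw [mem_Gr_diag₂_transpose]
  simp [graphComponent, Matrix.mulVec_mulVec, hAA]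

theorem sub_graphComponent_mem (A : Matrix (Fin n) (Fin n) ℝ) (u : PhaseSpace n × PhaseSpace n) :
    u - graphComponent A u ∈ mixedPlane n := by
  refine ⟨?_, ?_⟩ <;> ext i <;> simp [graphComponent]

theorem isCompl_mixedPlane_Gr {A : Matrix (Fin n) (Fin n) ℝ}
    (hA : A ∈ Matrix.orthogonalGroup (Fin n) ℝ) : IsCompl (mixedPlane n) (Gr (diag₂ A)ᵀ) := by
  have hAA' : A * Aᵀ = 1 := (Matrix.mem_orthogonalGroup_iff _ _).1 hA
  refine ⟨Submodule.disjoint_def.2 fun u hM hL => ?_, ?_⟩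
  · rw [mem_Gr_diag₂_transpose] at hL
    rw [mem_mixedPlane] at hM
    have h1 : u.2 ∘ Sum.inr = 0 := by rw [hL.2, hM.1, Matrix.mulVec_zero]
    have h2 : u.1 ∘ Sum.inl = 0 := by
      rw [← Matrix.one_mulVec (u.1 ∘ Sum.inl), ← hAA', ← Matrix.mulVec_mulVec, ← hL.1, hM.2,
        Matrix.mulVec_zero]
    ext (i | i)
    · exact congrFun h2 i
    · exact congrFun hM.1 i
    · exact congrFun hM.2 i
    · exact congrFun h1 i
  · rw [codisjoint_iff, Submodule.eq_top_iff']
    intro u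
    rw [← sub_add_cancel u (graphComponent A u)]
    exact Submodule.add_mem_sup (sub_graphComponent_mem A u) (graphComponent_mem hA u)

/-- The quadratic form `x₁·y₁ + y₂·x₂ - 2θ x₁·A y₂` on `ℝ²ⁿ × ℝ²ⁿ`. For `θ = 1` its pullback to a
Lagrangian subspace is the chart form of that subspace with respect to `Gr(A_dᵀ)` and
`mixedPlane`. -/
noncomputable def chartForm (A : Matrix (Fin n) (Fin n) ℝ) (θ : ℝ) :
    QuadraticForm ℝ (PhaseSpace n × PhaseSpace n) :=
  LinearMap.BilinMap.toQuadraticMap (LinearMap.mk₂ ℝ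
    (fun u w : PhaseSpace n × PhaseSpace n =>
      (u.1 ∘ Sum.inr) ⬝ᵥ (w.1 ∘ Sum.inl) + (u.2 ∘ Sum.inl) ⬝ᵥ (w.2 ∘ Sum.inr)
        - 2 * θ * ((u.1 ∘ Sum.inr) ⬝ᵥ (A *ᵥ (w.2 ∘ Sum.inl))))
    (fun u u' w => by simp only [Prod.fst_add, Prod.snd_add, Pi.add_comp, add_dotProduct]; ring)
    (fun c u w => by
      simp only [Prod.smul_fst, Prod.smul_snd, Pi.smul_comp, smul_dotProduct, smul_eq_mul]; ring)
    (fun u w w' => by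
      simp only [Prod.fst_add, Prod.snd_add, Pi.add_comp, dotProduct_add, Matrix.mulVec_add]; ring)
    (fun c u w => by
      simp only [Prod.smul_fst, Prod.smul_snd, Pi.smul_comp, dotProduct_smul, Matrix.mulVec_smul,
        smul_eq_mul]
      ring))

theorem chartForm_apply (A : Matrix (Fin n) (Fin n) ℝ) (θ : ℝ) (u : PhaseSpace n × PhaseSpace n) :
    chartForm A θ u = (u.1 ∘ Sum.inr) ⬝ᵥ (u.1 ∘ Sum.inl) + (u.2 ∘ Sum.inl) ⬝ᵥ (u.2 ∘ Sum.inr)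
        - 2 * θ * ((u.1 ∘ Sum.inr) ⬝ᵥ (A *ᵥ (u.2 ∘ Sum.inl))) := rfl

/-- On isotropic pairs, the polar form of `chartForm A θ` depends on `w` only through its coordinates
`(y₂, x₁)`. This exhibits the radical of the form on a Lagrangian subspace. -/
theorem polar_chartForm (A : Matrix (Fin n) (Fin n) ℝ) (θ : ℝ)
    (u w : PhaseSpace n × PhaseSpace n) (huw : graphForm n u w = 0) :
    QuadraticMap.polar (chartForm A θ) u w
      = 2 * ((w.1 ∘ Sum.inr) ⬝ᵥ (u.1 ∘ Sum.inl - θ • A *ᵥ (u.2 ∘ Sum.inl))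
        + (w.2 ∘ Sum.inl) ⬝ᵥ (u.2 ∘ Sum.inr - θ • Aᵀ *ᵥ (u.1 ∘ Sum.inr))) := by
  rw [graphForm_apply, omega_eq, omega_eq] at huw
  rw [chartForm, LinearMap.BilinMap.polar_toQuadraticMap, LinearMap.mk₂_apply,
    LinearMap.mk₂_apply, dotProduct_sub, dotProduct_sub, dotProduct_smul, dotProduct_smul,
    smul_eq_mul, smul_eq_mul]
  have h1 : (w.2 ∘ Sum.inl) ⬝ᵥ (Aᵀ *ᵥ (u.1 ∘ Sum.inr))
      = (u.1 ∘ Sum.inr) ⬝ᵥ (A *ᵥ (w.2 ∘ Sum.inl)) := by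
    rw [Matrix.dotProduct_mulVec, Matrix.vecMul_transpose, dotProduct_comm]
  rw [h1]
  have h2 := dotProduct_comm (w.1 ∘ Sum.inr) (u.1 ∘ Sum.inl)
  have h3 := dotProduct_comm (w.2 ∘ Sum.inl) (u.2 ∘ Sum.inr)
  linarith

section Parametrization

variable {Φ : PhaseSpace n →ₗ[ℝ] PhaseSpace n × PhaseSpace n}

/-- The coordinates `(y₂, x₁)` of the Lagrangian subspaces transverse to `mixedPlane`. -/
noncomputable def mixedCoord (n : ℕ) : PhaseSpace n × PhaseSpace n →ₗ[ℝ] PhaseSpace n where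
  toFun u := Sum.elim (u.2 ∘ Sum.inl) (u.1 ∘ Sum.inr)
  map_add' u w := by ext (i | i) <;> simp
  map_smul' c u := by ext (i | i) <;> simp

theorem mixedCoord_eq_zero_iff {u : PhaseSpace n × PhaseSpace n} :
    mixedCoord n u = 0 ↔ u ∈ mixedPlane n := by
  rw [mem_mixedPlane]
  constructor
  · intro h
    exact ⟨funext fun i => congrFun h (Sum.inr i), funext fun i => congrFun h (Sum.inl i)⟩
  · rintro ⟨h1, h2⟩
    ext (i | i)
    · exact congrFun h2 i
    · exact congrFun h1 i

theorem isCompl_mixedPlane_range (h : Function.Injective (mixedCoord n ∘ₗ Φ)) :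
    IsCompl (mixedPlane n) (LinearMap.range Φ) := by
  refine ⟨Submodule.disjoint_def.2 ?_, ?_⟩
  · rintro _ hM ⟨z, rfl⟩
    have : z = 0 := h (by rw [map_zero]; exact mixedCoord_eq_zero_iff.2 hM)
    rw [this, map_zero]
  · rw [codisjoint_iff, Submodule.eq_top_iff']
    intro u
    obtain ⟨z, hz⟩ := (LinearMap.injective_iff_surjective.1 h) (mixedCoord n u)
    rw [← sub_add_cancel u (Φ z)]
    refine Submodule.add_mem_sup (mixedCoord_eq_zero_iff.1 ?_) ⟨z, rfl⟩
    rw [map_sub, ← hz]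
    exact sub_self _

theorem chartCoindex_range_eq {A : Matrix (Fin n) (Fin n) ℝ}
    (hA : A ∈ Matrix.orthogonalGroup (Fin n) ℝ) (h : Function.Injective (mixedCoord n ∘ₗ Φ)) :
    chartCoindex (graphForm n) (Gr (diag₂ A)ᵀ) (mixedPlane n) (LinearMap.range Φ)
      = sigPos ((chartForm A 1).comp Φ) := by
  have hAA : Aᵀ * A = 1 := (Matrix.mem_orthogonalGroup_iff' _ _).1 hA
  have hsum : graphComponent A ∘ₗ Φ + (Φ - graphComponent A ∘ₗ Φ) = Φ := add_sub_cancel _ _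
  have hinj : Function.Injective Φ := by
    rw [LinearMap.coe_comp] at h
    exact h.of_comp
  have hdim : Module.finrank ℝ (PhaseSpace n) = Module.finrank ℝ (Gr (diag₂ A)ᵀ) := by
    have h1 := Submodule.finrank_add_eq_of_isCompl (isCompl_mixedPlane_Gr hA)
    have h2 := Submodule.finrank_add_eq_of_isCompl (isCompl_mixedPlane_range h)
    rw [LinearMap.finrank_range_of_inj hinj] at h2
    omega
  have := chartCoindex_eq_sigPos (graphForm n) (L₀ := Gr (diag₂ A)ᵀ) (M := mixedPlane n)
    (graphComponent A ∘ₗ Φ) (Φ - graphComponent A ∘ₗ Φ) (fun z => graphComponent_mem hA _)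
    (fun z => sub_graphComponent_mem A _) (by rw [hsum]; exact hinj)
    (by rw [hsum]; exact isCompl_mixedPlane_range h) hdim
  rw [hsum] at this
  rw [this]
  congr 1
  ext z
  change graphForm n (graphComponent A (Φ z)) (Φ z - graphComponent A (Φ z)) = chartForm A 1 (Φ z)
  generalize Φ z = u
  have hc : ∀ p q : PhaseSpace n, (p - q) ∘ Sum.inl = p ∘ Sum.inl - q ∘ Sum.inl ∧
      (p - q) ∘ Sum.inr = p ∘ Sum.inr - q ∘ Sum.inr := fun _ _ => ⟨rfl, rfl⟩
  have h1 : (u.2 ∘ Sum.inl) ⬝ᵥ (Aᵀ *ᵥ (u.1 ∘ Sum.inr))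
      = (u.1 ∘ Sum.inr) ⬝ᵥ (A *ᵥ (u.2 ∘ Sum.inl)) := by
    rw [Matrix.dotProduct_mulVec, Matrix.vecMul_transpose, dotProduct_comm]
  simp only [graphComponent, LinearMap.coe_mk, AddHom.coe_mk, graphForm_apply, omega_eq,
    Prod.fst_sub, Prod.snd_sub, (hc _ _).1, (hc _ _).2, Sum.elim_comp_inl, Sum.elim_comp_inr,
    sub_self, dotProduct_zero, dotProduct_sub, h1, chartForm_apply]
  ring

/-- On a Lagrangian subspace transverse to `mixedPlane`, the radical of `chartForm A θ` is cut out by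
`y₁ = θ A y₂` and `x₂ = θ Aᵀ x₁`. -/
theorem radical_chartForm_comp_eq_bot {A : Matrix (Fin n) (Fin n) ℝ} {θ : ℝ}
    (h : Function.Injective (mixedCoord n ∘ₗ Φ))
    (hiso : ∀ z z', graphForm n (Φ z) (Φ z') = 0)
    (hker : ∀ z, (Φ z).1 ∘ Sum.inl = θ • A *ᵥ ((Φ z).2 ∘ Sum.inl) →
      (Φ z).2 ∘ Sum.inr = θ • Aᵀ *ᵥ ((Φ z).1 ∘ Sum.inr) → z = 0) :
    ((chartForm A θ).comp Φ).radical = ⊥ := by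
  rw [Submodule.eq_bot_iff]
  intro z hz
  rw [mem_radical_iff_polar] at hz
  have hpol : ∀ z', QuadraticMap.polar ((chartForm A θ).comp Φ) z z'
      = QuadraticMap.polar (chartForm A θ) (Φ z) (Φ z') := by
    intro z'
    simp [QuadraticMap.polar]
  obtain ⟨z', hz'⟩ := (LinearMap.injective_iff_surjective.1 h)
    (Sum.elim ((Φ z).2 ∘ Sum.inr - θ • Aᵀ *ᵥ ((Φ z).1 ∘ Sum.inr))
      ((Φ z).1 ∘ Sum.inl - θ • A *ᵥ ((Φ z).2 ∘ Sum.inl)))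
  have h0 := hz z'
  have h1 : (Φ z').1 ∘ Sum.inr = (Φ z).1 ∘ Sum.inl - θ • A *ᵥ ((Φ z).2 ∘ Sum.inl) :=
    congrArg (· ∘ Sum.inr) hz'
  have h2 : (Φ z').2 ∘ Sum.inl = (Φ z).2 ∘ Sum.inr - θ • Aᵀ *ᵥ ((Φ z).1 ∘ Sum.inr) :=
    congrArg (· ∘ Sum.inl) hz'
  rw [hpol, polar_chartForm A θ _ _ (hiso z z'), h1, h2] at h0
  set p := (Φ z).1 ∘ Sum.inl - θ • A *ᵥ ((Φ z).2 ∘ Sum.inl)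
  set q := (Φ z).2 ∘ Sum.inr - θ • Aᵀ *ᵥ ((Φ z).1 ∘ Sum.inr)
  have hp : 0 ≤ p ⬝ᵥ p := Finset.sum_nonneg fun i _ => mul_self_nonneg _
  have hq : 0 ≤ q ⬝ᵥ q := Finset.sum_nonneg fun i _ => mul_self_nonneg _
  exact hker z (sub_eq_zero.1 (dotProduct_self_eq_zero.1 (by linarith)))
    (sub_eq_zero.1 (dotProduct_self_eq_zero.1 (by linarith)))

/-- Vectors of a Lagrangian subspace that lie in `Gr(A_dᵀ)` belong to the radical of the chart form. -/
theorem range_inf_Gr_eq_bot {A : Matrix (Fin n) (Fin n) ℝ}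
    (hA : A ∈ Matrix.orthogonalGroup (Fin n) ℝ)
    (hiso : ∀ z z', graphForm n (Φ z) (Φ z') = 0)
    (hrad : ((chartForm A 1).comp Φ).radical = ⊥) :
    LinearMap.range Φ ⊓ Gr (diag₂ A)ᵀ = ⊥ := by
  have hAA' : A * Aᵀ = 1 := (Matrix.mem_orthogonalGroup_iff _ _).1 hA
  rw [Submodule.eq_bot_iff]
  rintro _ ⟨⟨z, rfl⟩, hL⟩
  have hL' := mem_Gr_diag₂_transpose.1 hL
  have hz : z ∈ ((chartForm A 1).comp Φ).radical := by
    rw [mem_radical_iff_polar]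
    intro z'
    have : QuadraticMap.polar ((chartForm A 1).comp Φ) z z'
        = QuadraticMap.polar (chartForm A 1) (Φ z) (Φ z') := by
      simp [QuadraticMap.polar]
    rw [this, polar_chartForm A 1 _ _ (hiso z z'), hL'.1, hL'.2, Matrix.mulVec_mulVec, hAA']
    simp
  rw [hrad, Submodule.mem_bot] at hz
  rw [hz, map_zero]

end Parametrization

end Coordinates

/-! ### Rotated graphs and the index at the initial time -/

section RotatedGraph

variable {n : ℕ}

/-- The parametrization `z ↦ e^{-ε𝒥} (z, ψ z) = (e^{εJ} z, e^{-εJ} ψ z)` of the rotated graph of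
`ψ`. -/
noncomputable def rotatedGraph (ψ : Matrix (Fin n ⊕ Fin n) (Fin n ⊕ Fin n) ℝ) (ε : ℝ) :
    PhaseSpace n →ₗ[ℝ] PhaseSpace n × PhaseSpace n :=
  rotation (graphJ n) (-ε) ∘ₗ LinearMap.id.prod ψ.mulVecLin

theorem range_rotatedGraph (ψ : Matrix (Fin n ⊕ Fin n) (Fin n ⊕ Fin n) ℝ) (ε : ℝ) :
    LinearMap.range (rotatedGraph ψ ε) = (Gr ψ).map (rotation (graphJ n) (-ε)) := by
  rw [rotatedGraph, LinearMap.range_comp, Gr, LinearMap.graph_eq_range_prod]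

theorem rotatedGraph_apply (ψ : Matrix (Fin n ⊕ Fin n) (Fin n ⊕ Fin n) ℝ) (ε : ℝ)
    (z : PhaseSpace n) :
    rotatedGraph ψ ε z = Real.cos ε • (z, ψ *ᵥ z) - Real.sin ε • graphJ n (z, ψ *ᵥ z) := by
  simp [rotatedGraph, rotation, sub_eq_add_neg]

theorem rotatedGraph_zero (ψ : Matrix (Fin n ⊕ Fin n) (Fin n ⊕ Fin n) ℝ) (z : PhaseSpace n) :
    rotatedGraph ψ 0 z = (z, ψ *ᵥ z) := by
  simp [rotatedGraph_apply]

theorem J_mulVec_inl (z : PhaseSpace n) :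
    (Matrix.J (Fin n) ℝ *ᵥ z) ∘ Sum.inl = -(z ∘ Sum.inr) := by
  rw [Matrix.J, Matrix.fromBlocks_mulVec, Sum.elim_comp_inl]
  simp [Matrix.neg_mulVec]

theorem J_mulVec_inr (z : PhaseSpace n) :
    (Matrix.J (Fin n) ℝ *ᵥ z) ∘ Sum.inr = z ∘ Sum.inl := by
  rw [Matrix.J, Matrix.fromBlocks_mulVec, Sum.elim_comp_inr]
  simp

section Components

variable (ψ : Matrix (Fin n ⊕ Fin n) (Fin n ⊕ Fin n) ℝ) (ε : ℝ) (z : PhaseSpace n)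

theorem rotatedGraph_fst_inl : (rotatedGraph ψ ε z).1 ∘ Sum.inl
    = Real.cos ε • (z ∘ Sum.inl) - Real.sin ε • (z ∘ Sum.inr) := by
  have : (rotatedGraph ψ ε z).1 = Real.cos ε • z + Real.sin ε • (Matrix.J (Fin n) ℝ *ᵥ z) := by
    simp [rotatedGraph_apply, graphJ]
  rw [this, Pi.add_comp, Pi.smul_comp, Pi.smul_comp, J_mulVec_inl, smul_neg, sub_eq_add_neg]

theorem rotatedGraph_fst_inr : (rotatedGraph ψ ε z).1 ∘ Sum.inr
    = Real.cos ε • (z ∘ Sum.inr) + Real.sin ε • (z ∘ Sum.inl) := by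
  have : (rotatedGraph ψ ε z).1 = Real.cos ε • z + Real.sin ε • (Matrix.J (Fin n) ℝ *ᵥ z) := by
    simp [rotatedGraph_apply, graphJ]
  rw [this, Pi.add_comp, Pi.smul_comp, Pi.smul_comp, J_mulVec_inr]

theorem rotatedGraph_snd_inl : (rotatedGraph ψ ε z).2 ∘ Sum.inl
    = Real.cos ε • ((ψ *ᵥ z) ∘ Sum.inl) + Real.sin ε • ((ψ *ᵥ z) ∘ Sum.inr) := by
  have : (rotatedGraph ψ ε z).2
      = Real.cos ε • (ψ *ᵥ z) + -(Real.sin ε • (Matrix.J (Fin n) ℝ *ᵥ (ψ *ᵥ z))) := by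
    simp [rotatedGraph_apply, graphJ, sub_eq_add_neg]
  rw [this, Pi.add_comp, Pi.neg_comp, Pi.smul_comp, Pi.smul_comp, J_mulVec_inl, smul_neg, neg_neg]

theorem rotatedGraph_snd_inr : (rotatedGraph ψ ε z).2 ∘ Sum.inr
    = Real.cos ε • ((ψ *ᵥ z) ∘ Sum.inr) - Real.sin ε • ((ψ *ᵥ z) ∘ Sum.inl) := by
  have : (rotatedGraph ψ ε z).2
      = Real.cos ε • (ψ *ᵥ z) + -(Real.sin ε • (Matrix.J (Fin n) ℝ *ᵥ (ψ *ᵥ z))) := by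
    simp [rotatedGraph_apply, graphJ, sub_eq_add_neg]
  rw [this, Pi.add_comp, Pi.neg_comp, Pi.smul_comp, Pi.smul_comp, J_mulVec_inr, sub_eq_add_neg]

end Components

/-- Rotated graphs of symplectic matrices are isotropic. -/
theorem graphForm_rotatedGraph {ψ : Matrix (Fin n ⊕ Fin n) (Fin n ⊕ Fin n) ℝ}
    (hψ : ∀ z z', omega n (ψ *ᵥ z) (ψ *ᵥ z') = omega n z z') (ε : ℝ) (z z' : PhaseSpace n) :
    graphForm n (rotatedGraph ψ ε z) (rotatedGraph ψ ε z') = 0 := by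
  have h := hψ z z'
  have hcs := Real.cos_sq_add_sin_sq ε
  rw [omega_eq, omega_eq] at h
  rw [graphForm_apply, omega_eq, omega_eq]
  simp only [rotatedGraph_fst_inl, rotatedGraph_fst_inr, rotatedGraph_snd_inl,
    rotatedGraph_snd_inr, dotProduct_add, add_dotProduct, dotProduct_sub, sub_dotProduct,
    dotProduct_smul, smul_dotProduct, smul_eq_mul]
  linear_combination (Real.cos ε ^ 2 + Real.sin ε ^ 2) * h

theorem continuous_chartForm (A : Matrix (Fin n) (Fin n) ℝ) (θ : ℝ) :
    Continuous fun u => chartForm A θ u := by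
  simp only [chartForm_apply]
  have h1 : Continuous fun u : PhaseSpace n × PhaseSpace n => u.1 ∘ (Sum.inl : Fin n → _) := by
    fun_prop
  fun_prop

theorem continuous_rotatedGraph_apply {X : Type*} [TopologicalSpace X]
    {ψ : X → Matrix (Fin n ⊕ Fin n) (Fin n ⊕ Fin n) ℝ} {ε : X → ℝ} (hψ : Continuous ψ)
    (hε : Continuous ε) (z : PhaseSpace n) : Continuous fun p => rotatedGraph (ψ p) (ε p) z := by
  simp only [rotatedGraph_apply]
  have h1 : Continuous fun p => (z, ψ p *ᵥ z) := by fun_prop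
  have h2 : Continuous (graphJ n) := LinearMap.continuous_of_finiteDimensional _
  exact ((Real.continuous_cos.comp hε).smul h1).sub
    ((Real.continuous_sin.comp hε).smul (h2.comp h1))

/-- The positive index at the initial time, where the path starts on the Maslov cycle unless
`ker (A - 1) = 0`. On the sum of two copies of `range (A - 1)` the unrotated form is nondegenerate
of signature zero; on the sum of two copies of `ker (A - 1)`, where the unrotated form vanishes, the
rotation by a small positive angle makes the form negative definite. -/
theorem eventually_sigPos_initial {A : Matrix (Fin n) (Fin n) ℝ}
    (hA : A ∈ Matrix.orthogonalGroup (Fin n) ℝ) :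
    ∀ᶠ ε in 𝓝[>] (0 : ℝ),
      sigPos ((chartForm A 1).comp (rotatedGraph 1 ε))
        + Module.finrank ℝ (LinearMap.ker (A - 1).mulVecLin) = n ∧
      ((chartForm A 1).comp (rotatedGraph 1 ε)).radical = ⊥ := by
  have hAA : Aᵀ * A = 1 := (Matrix.mem_orthogonalGroup_iff' _ _).1 hA
  let K := LinearMap.ker (A - 1).mulVecLin
  let R := LinearMap.range (A - 1).mulVecLin
  have hdim : Module.finrank ℝ R + Module.finrank ℝ K = n := by
    have := LinearMap.finrank_range_add_finrank_ker (A - 1).mulVecLin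
    rwa [Module.finrank_fin_fun] at this
  have hK : ∀ k ∈ K, A *ᵥ k = k := by
    intro k hk
    have : (A - 1) *ᵥ k = 0 := hk
    rwa [Matrix.sub_mulVec, Matrix.one_mulVec, sub_eq_zero] at this
  have hK' : ∀ k ∈ K, Aᵀ *ᵥ k = k := by
    intro k hk
    conv_lhs => rw [← hK k hk]
    rw [Matrix.mulVec_mulVec, hAA, Matrix.one_mulVec]
  have hadj : ∀ v w : Fin n → ℝ, (A *ᵥ v) ⬝ᵥ w = v ⬝ᵥ (Aᵀ *ᵥ w) := by
    intro v w
    rw [Matrix.dotProduct_mulVec, Matrix.vecMul_transpose]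
  have hRK : ∀ r ∈ R, ∀ k ∈ K, r ⬝ᵥ k = 0 := by
    rintro _ ⟨u, rfl⟩ k hk
    rw [Matrix.mulVecLin_apply, Matrix.sub_mulVec, Matrix.one_mulVec, sub_dotProduct, hadj,
      hK' k hk, sub_self]
  have hR0 : ∀ r ∈ R, r ≠ 0 → 0 < (r - A *ᵥ r) ⬝ᵥ (r - A *ᵥ r) := by
    intro r hr hne
    refine lt_of_le_of_ne (Finset.sum_nonneg fun i _ => mul_self_nonneg _) fun h => hne ?_
    have h1 := dotProduct_self_eq_zero.1 h.symm
    refine dotProduct_self_eq_zero.1 (hRK r hr r ?_)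
    change (A - 1) *ᵥ r = 0
    rw [Matrix.sub_mulVec, Matrix.one_mulVec, ← neg_sub, h1, neg_zero]
  have hiso : ∀ ε z z', graphForm n (rotatedGraph 1 ε z) (rotatedGraph 1 ε z') = 0 :=
    graphForm_rotatedGraph fun z z' => by rw [Matrix.one_mulVec, Matrix.one_mulVec]
  -- `f c` embeds `range (A - 1)` as the graph of `y ↦ x = c (y - A y)`.
  let f : ℝ → R →ₗ[ℝ] PhaseSpace n := fun c =>
    (LinearEquiv.sumArrowLequivProdArrow (Fin n) (Fin n) ℝ ℝ).symm.toLinearMap ∘ₗ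
      (LinearMap.id.prod (c • (1 - A).mulVecLin)) ∘ₗ R.subtype
  have hf_inl : ∀ c r, f c r ∘ Sum.inl = r := fun c r => rfl
  have hf_inr : ∀ c r, f c r ∘ Sum.inr = c • (r - A *ᵥ r) := by
    intro c r
    have : (1 - A) *ᵥ (r : Fin n → ℝ) = (r : Fin n → ℝ) - A *ᵥ r := by
      rw [Matrix.sub_mulVec, Matrix.one_mulVec]
    rw [← this]
    rfl
  let g : K × K →ₗ[ℝ] PhaseSpace n :=
    (LinearEquiv.sumArrowLequivProdArrow (Fin n) (Fin n) ℝ ℝ).symm.toLinearMap ∘ₗ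
      K.subtype.prodMap K.subtype
  have hg_inl : ∀ k, g k ∘ Sum.inl = k.1 := fun k => rfl
  have hg_inr : ∀ k, g k ∘ Sum.inr = k.2 := fun k => rfl
  let Q : ℝ → QuadraticForm ℝ (PhaseSpace n) := fun ε => (chartForm A 1).comp (rotatedGraph 1 ε)
  have hlim : ∀ z, Tendsto (fun ε => Q ε z) (𝓝[>] 0) (𝓝 (Q 0 z)) := fun z =>
    (((continuous_chartForm A 1).comp
      (continuous_rotatedGraph_apply continuous_const continuous_id z)).tendsto 0).mono_left
        nhdsWithin_le_nhds
  have hQ0 : ∀ c (r : R), Q 0 (f c r)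
      = 2 * c * (((r : Fin n → ℝ) - A *ᵥ r) ⬝ᵥ ((r : Fin n → ℝ) - A *ᵥ r)) := by
    intro c r
    change chartForm A 1 (rotatedGraph 1 0 (f c r)) = _
    rw [rotatedGraph_zero, Matrix.one_mulVec, chartForm_apply]
    simp only [hf_inl, hf_inr]
    rw [dotProduct_comm (r : Fin n → ℝ) (c • _), smul_dotProduct, smul_dotProduct, dotProduct_sub]
    simp only [smul_eq_mul]
    ring
  have hpos : ∀ᶠ ε in 𝓝[>] (0 : ℝ), ((Q ε).comp (f 1)).PosDef := by
    refine eventually_posDef_of_tendsto (Q₀ := (Q 0).comp (f 1)) (fun r => hlim (f 1 r)) ?_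
    intro r hr
    have := hR0 r r.2 (by simpa using hr)
    rw [QuadraticMap.comp_apply, hQ0]
    linarith
  have hneg : ∀ᶠ ε in 𝓝[>] (0 : ℝ), ((-Q ε).comp (f (-1))).PosDef := by
    refine eventually_posDef_of_tendsto (Q₀ := (-Q 0).comp (f (-1)))
      (fun r => (hlim (f (-1) r)).neg) ?_
    intro r hr
    have := hR0 r r.2 (by simpa using hr)
    rw [QuadraticMap.comp_apply, neg_apply, hQ0]
    linarith
  have hsin : ∀ᶠ ε in 𝓝[>] (0 : ℝ), 0 < Real.sin ε := by
    filter_upwards [Ioo_mem_nhdsGT Real.pi_pos] with ε hε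
    exact Real.sin_pos_of_mem_Ioo hε
  have hcos : ∀ᶠ ε in 𝓝[>] (0 : ℝ), Real.sin ε < Real.cos ε := by
    refine Filter.Eventually.filter_mono nhdsWithin_le_nhds ?_
    exact Real.continuous_sin.continuousAt.eventually_lt Real.continuous_cos.continuousAt (by simp)
  filter_upwards [hpos, hneg, hsin, hcos] with ε h1 h2 h3 h4
  have hpol : ∀ z z', QuadraticMap.polar (Q ε) z z'
      = QuadraticMap.polar (chartForm A 1) (rotatedGraph 1 ε z) (rotatedGraph 1 ε z') := by
    intro z z'
    simp [Q, QuadraticMap.polar]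
  have hpolg : ∀ k z, QuadraticMap.polar (Q ε) (g k) z
      = -4 * Real.sin ε * ((Real.cos ε • (z ∘ Sum.inr) + Real.sin ε • (z ∘ Sum.inl)) ⬝ᵥ k.2
        + (Real.cos ε • (z ∘ Sum.inl) + Real.sin ε • (z ∘ Sum.inr)) ⬝ᵥ k.1) := by
    intro k z
    rw [hpol, polar_chartForm A 1 _ _ (hiso ε _ _)]
    simp only [rotatedGraph_fst_inl, rotatedGraph_fst_inr, rotatedGraph_snd_inl,
      rotatedGraph_snd_inr, Matrix.one_mulVec, hg_inl, hg_inr, Matrix.mulVec_add,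
      Matrix.mulVec_smul, hK _ k.1.2, hK _ k.2.2, hK' _ k.1.2, hK' _ k.2.2, one_smul]
    have e1 : Real.cos ε • (k.1 : Fin n → ℝ) - Real.sin ε • (k.2 : Fin n → ℝ)
        - (Real.cos ε • (k.1 : Fin n → ℝ) + Real.sin ε • (k.2 : Fin n → ℝ))
        = (-2 * Real.sin ε) • (k.2 : Fin n → ℝ) := by module
    have e2 : Real.cos ε • (k.2 : Fin n → ℝ) - Real.sin ε • (k.1 : Fin n → ℝ)
        - (Real.cos ε • (k.2 : Fin n → ℝ) + Real.sin ε • (k.1 : Fin n → ℝ))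
        = (-2 * Real.sin ε) • (k.1 : Fin n → ℝ) := by module
    rw [e1, e2, dotProduct_smul, dotProduct_smul]
    simp only [smul_eq_mul]
    ring
  have hgf : ∀ k c r, QuadraticMap.polar (Q ε) (g k) (f c r) = 0 := by
    intro k c r
    have o1 : ∀ k : K, (r : Fin n → ℝ) ⬝ᵥ k = 0 := fun k => hRK r r.2 k k.2
    have o2 : ∀ k : K, (A *ᵥ (r : Fin n → ℝ)) ⬝ᵥ k = 0 := fun k => by
      rw [hadj, hK' k k.2, o1]
    rw [hpolg, hf_inl, hf_inr]
    simp [add_dotProduct, sub_dotProduct, smul_dotProduct, o1, o2]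
  have hgg : ∀ k, k ≠ 0 → Q ε (g k) < 0 := by
    intro k hk
    have e1 := hpolg k (g k)
    rw [QuadraticMap.polar_self, hg_inl, hg_inr] at e1
    simp only [add_dotProduct, smul_dotProduct, smul_eq_mul, nsmul_eq_mul] at e1
    have e2 : 0 ≤ ((k.1 : Fin n → ℝ) + (k.2 : Fin n → ℝ)) ⬝ᵥ ((k.1 : Fin n → ℝ) + (k.2 : Fin n → ℝ)) :=
      Finset.sum_nonneg fun i _ => mul_self_nonneg _
    rw [add_dotProduct, dotProduct_add, dotProduct_add,
      dotProduct_comm (k.2 : Fin n → ℝ) (k.1 : Fin n → ℝ)] at e2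
    rw [dotProduct_comm (k.2 : Fin n → ℝ) (k.1 : Fin n → ℝ)] at e1
    have p1 : 0 ≤ (k.1 : Fin n → ℝ) ⬝ᵥ k.1 := Finset.sum_nonneg fun i _ => mul_self_nonneg _
    have p2 : 0 ≤ (k.2 : Fin n → ℝ) ⬝ᵥ k.2 := Finset.sum_nonneg fun i _ => mul_self_nonneg _
    have e3 : 0 < (k.1 : Fin n → ℝ) ⬝ᵥ k.1 + (k.2 : Fin n → ℝ) ⬝ᵥ k.2 := by
      refine lt_of_le_of_ne (add_nonneg p1 p2) fun h => hk ?_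
      ext1
      · exact Subtype.ext (dotProduct_self_eq_zero.1 (by linarith))
      · exact Subtype.ext (dotProduct_self_eq_zero.1 (by linarith))
    have e4 : 0 < Real.sin ε * ((Real.cos ε - Real.sin ε)
        * ((k.1 : Fin n → ℝ) ⬝ᵥ k.1 + (k.2 : Fin n → ℝ) ⬝ᵥ k.2)) :=
      mul_pos h3 (mul_pos (sub_pos.2 h4) e3)
    have e5 := mul_nonneg (mul_nonneg h3.le h3.le) e2
    push_cast at e1
    nlinarith
  have hP : Module.finrank ℝ R ≤ sigPos (Q ε) := finrank_le_sigPos_of_comp_posDef _ h1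
  have hN : Module.finrank ℝ R + (Module.finrank ℝ K + Module.finrank ℝ K) ≤ sigNeg (Q ε) := by
    rw [← Module.finrank_prod (M := K) (M' := K), ← Module.finrank_prod, ← sigPos_neg]
    refine finrank_le_sigPos_of_comp_posDef ((f (-1)).coprod g) ?_
    rintro ⟨r, k⟩ hrk
    have e1 : Q ε (f (-1) r + g k) = Q ε (f (-1) r) + Q ε (g k) := by
      rw [add_comm, QuadraticMap.map_add (Q ε), hgf]
      ring
    have e2 : 0 ≤ -Q ε (f (-1) r) := h2.nonneg r
    change 0 < -Q ε (f (-1) r + g k)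
    rw [e1]
    by_cases hk : k = 0
    · have hr : r ≠ 0 := by
        rintro rfl
        exact hrk (by rw [hk]; rfl)
      have e3 : 0 < -Q ε (f (-1) r) := h2 r hr
      rw [hk, map_zero, map_zero]
      linarith
    · have := hgg k hk
      linarith
  have htot := QuadraticForm.sigPos_add_sigNeg_add_radical (Q := Q ε)
  have hZ : Module.finrank ℝ (PhaseSpace n) = n + n := by
    rw [Module.finrank_fintype_fun_eq_card, Fintype.card_sum, Fintype.card_fin]
  have hrad : Module.finrank ℝ (Q ε).radical = 0 := by omega
  refine ⟨?_, Submodule.finrank_eq_zero.1 hrad⟩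
  change sigPos (Q ε) + Module.finrank ℝ K = n
  omega

end RotatedGraph

/-! ### The index at the final time -/

section Final

variable {n : ℕ} {P : ℝ → Matrix (Fin n) (Fin n) ℝ} {s T : ℝ}
  {ψ : ℝ → Matrix (Fin n ⊕ Fin n) (Fin n ⊕ Fin n) ℝ}

theorem IsFundamentalSolution.omega_mulVec (hψ : IsFundamentalSolution (hamB P s) T ψ)
    (hP : ∀ t ∈ Icc 0 T, (P t).IsSymm) {t : ℝ} (ht : t ∈ Icc 0 T) (z z' : PhaseSpace n) :
    omega n (ψ t *ᵥ z) (ψ t *ᵥ z') = omega n z z' := by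
  have := (hψ.isSolution z).wronskian_eq hP (hψ.isSolution z') ht
  simp only [hψ.1, Matrix.one_mulVec] at this
  rw [omega_eq, omega_eq, this]

/-- The conclusion of `exists_threshold`: along a nonzero solution, the function `⟨x, P⁻¹ y⟩` does
not return to its initial value. -/
def SeparatesTimes (P : ℝ → Matrix (Fin n) (Fin n) ℝ) (s T : ℝ) : Prop :=
  ∀ y x, IsSolution P s T y x → ∀ t ∈ Ioc 0 T,
    x 0 ⬝ᵥ ((P 0)⁻¹ *ᵥ y 0) = x t ⬝ᵥ ((P t)⁻¹ *ᵥ y t) → y 0 = 0 ∧ x 0 = 0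

theorem SeparatesTimes.eq_zero (h : SeparatesTimes P s T)
    (hψ : IsFundamentalSolution (hamB P s) T ψ) {t : ℝ} (ht : t ∈ Ioc 0 T) {z : PhaseSpace n}
    (hz : (z ∘ Sum.inr) ⬝ᵥ ((P 0)⁻¹ *ᵥ (z ∘ Sum.inl))
      = ((ψ t *ᵥ z) ∘ Sum.inr) ⬝ᵥ ((P t)⁻¹ *ᵥ ((ψ t *ᵥ z) ∘ Sum.inl))) : z = 0 := by
  have := h _ _ (hψ.isSolution z) t ht (by simpa only [hψ.1, Matrix.one_mulVec] using hz)
  simp only [hψ.1, Matrix.one_mulVec] at this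
  ext (i | i)
  · exact congrFun this.1 i
  · exact congrFun this.2 i

theorem injective_mixedCoord_rotatedGraph_iff {N : Matrix (Fin n ⊕ Fin n) (Fin n ⊕ Fin n) ℝ}
    {ε : ℝ} : Function.Injective (mixedCoord n ∘ₗ rotatedGraph N ε) ↔
      ∀ z, (rotatedGraph N ε z).1 ∘ Sum.inr = 0 → (rotatedGraph N ε z).2 ∘ Sum.inl = 0 → z = 0 := by
  rw [← LinearMap.ker_eq_bot, LinearMap.ker_eq_bot']
  refine forall_congr' fun z => ?_
  rw [LinearMap.comp_apply, mixedCoord_eq_zero_iff, mem_mixedPlane, and_imp]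

/-- The Dirichlet-Neumann problem `x(0) = 0`, `y(t) = 0` has only the trivial solution. -/
theorem SeparatesTimes.injective_mixedCoord (h : SeparatesTimes P s T)
    (hψ : IsFundamentalSolution (hamB P s) T ψ) {t : ℝ} (ht : t ∈ Icc 0 T) :
    Function.Injective (mixedCoord n ∘ₗ rotatedGraph (ψ t) 0) := by
  rw [injective_mixedCoord_rotatedGraph_iff]
  intro z h1 h2
  rw [rotatedGraph_zero] at h1 h2
  simp only at h1 h2
  rcases ht.1.eq_or_lt with rfl | h0
  · rw [hψ.1, Matrix.one_mulVec] at h2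
    ext (i | i)
    · exact congrFun h2 i
    · exact congrFun h1 i
  · refine h.eq_zero hψ ⟨h0, ht.2⟩ ?_
    rw [h1, h2, zero_dotProduct, Matrix.mulVec_zero, dotProduct_zero]

theorem SeparatesTimes.eventually_injective_mixedCoord (h : SeparatesTimes P s T)
    (hψ : IsFundamentalSolution (hamB P s) T ψ) : ∀ᶠ ε in 𝓝 (0 : ℝ), ∀ t ∈ Icc 0 T,
      Function.Injective (mixedCoord n ∘ₗ rotatedGraph (ψ t) ε) := by
  let F : ℝ × Icc 0 T → (PhaseSpace n →ₗ[ℝ] PhaseSpace n) := fun p =>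
    mixedCoord n ∘ₗ rotatedGraph (ψ p.2) p.1
  have hψc : Continuous fun p : ℝ × Icc 0 T => ψ p.2 :=
    (continuousOn_iff_continuous_domRestrict.1 hψ.continuousOn).comp continuous_snd
  have hF : ∀ z, Continuous fun p => F p z := fun z =>
    (LinearMap.continuous_of_finiteDimensional (mixedCoord n)).comp
      (continuous_rotatedGraph_apply hψc continuous_fst z)
  have hdet : Continuous fun p => LinearMap.det (F p) := by
    simp only [← LinearMap.det_toMatrix']
    refine Continuous.matrix_det (continuous_pi fun i => continuous_pi fun j => ?_)
    simp only [LinearMap.toMatrix'_apply]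
    exact (continuous_apply i).comp (hF _)
  have hinj : ∀ p, Function.Injective (F p) ↔ LinearMap.det (F p) ≠ 0 := by
    intro p
    rw [← LinearMap.ker_eq_bot, ← LinearMap.isUnit_iff_ker_eq_bot,
      LinearMap.isUnit_iff_isUnit_det, isUnit_iff_ne_zero]
  have := (isCompact_univ (X := Icc 0 T)).eventually_forall_of_forall_eventually (x₀ := (0 : ℝ))
    (P := fun ε t => Function.Injective (F (ε, t))) fun t _ => by
      simp only [hinj]
      exact hdet.continuousAt.eventually_ne
        ((hinj _).1 (h.injective_mixedCoord hψ t.2))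
  filter_upwards [this] with ε hε t ht
  exact hε ⟨t, ht⟩ (mem_univ _)

theorem continuousOn_rotatedGraph (hψ : IsFundamentalSolution (hamB P s) T ψ) (ε : ℝ)
    (z : PhaseSpace n) : ContinuousOn (fun t => rotatedGraph (ψ t) ε z) (Icc 0 T) := by
  rw [continuousOn_iff_continuous_domRestrict]
  exact continuous_rotatedGraph_apply (continuousOn_iff_continuous_domRestrict.1 hψ.continuousOn)
    continuous_const z

/-- The form `2 x·y` has signature zero. -/
theorem sigPos_chartForm_zero (A : Matrix (Fin n) (Fin n) ℝ) :
    sigPos ((chartForm A 0).comp (rotatedGraph 1 0)) = n := by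
  let f : ℝ → (Fin n → ℝ) →ₗ[ℝ] PhaseSpace n := fun c =>
    (LinearEquiv.sumArrowLequivProdArrow (Fin n) (Fin n) ℝ ℝ).symm.toLinearMap ∘ₗ
      (LinearMap.id.prod (c • LinearMap.id))
  have hf : ∀ c y, (chartForm A 0).comp (rotatedGraph 1 0) (f c y) = 2 * c * (y ⬝ᵥ y) := by
    intro c y
    have h1 : f c y ∘ Sum.inl = y := rfl
    have h2 : f c y ∘ Sum.inr = c • y := rfl
    rw [QuadraticMap.comp_apply, rotatedGraph_zero, Matrix.one_mulVec, chartForm_apply]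
    simp only [h1, h2, smul_dotProduct, dotProduct_smul, smul_eq_mul]
    ring
  have hpos : ∀ y : Fin n → ℝ, y ≠ 0 → 0 < y ⬝ᵥ y := fun y hy =>
    lt_of_le_of_ne (Finset.sum_nonneg fun i _ => mul_self_nonneg _)
      fun h => hy (dotProduct_self_eq_zero.1 h.symm)
  have h1 := finrank_le_sigPos_of_comp_posDef (Q := (chartForm A 0).comp (rotatedGraph 1 0)) (f 1)
    fun y hy => by
      have := hpos y hy
      rw [QuadraticMap.comp_apply, hf]
      linarith
  have h2 := finrank_le_sigPos_of_comp_posDef (Q := -(chartForm A 0).comp (rotatedGraph 1 0))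
    (f (-1)) fun y hy => by
      have := hpos y hy
      rw [QuadraticMap.comp_apply, neg_apply, hf]
      linarith
  have h3 := QuadraticForm.sigPos_add_sigNeg_add_radical
    (Q := (chartForm A 0).comp (rotatedGraph 1 0))
  rw [sigPos_neg] at h2
  rw [Module.finrank_fintype_fun_eq_card, Fintype.card_sum, Fintype.card_fin] at h3
  rw [Module.finrank_fin_fun] at h1 h2
  omega

/-- Nondegeneracy of the forms that join `2 x·y` at time `0` to the chart form at time `T`: first
`t` moves from `0` to `T` with `θ = 0`, then `θ` moves from `0` to `1` at `t = T`. A vector in the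
radical is a solution with `y(0) = θ A y(t)`, `x(t) = θ Aᵀ x(0)`; then `⟨x, P⁻¹ y⟩` takes the same
value at `0` and at `t`. -/
theorem SeparatesTimes.radical_eq_bot (h : SeparatesTimes P s T)
    (hψ : IsFundamentalSolution (hamB P s) T ψ) (hP : ∀ t ∈ Icc 0 T, (P t).IsSymm)
    {A : Matrix (Fin n) (Fin n) ℝ} {θ t : ℝ} (ht : t ∈ Icc 0 T)
    (hA : θ = 0 ∨ (0 < t ∧ (P 0)⁻¹ * A = A * (P t)⁻¹)) :
    ((chartForm A θ).comp (rotatedGraph (ψ t) 0)).radical = ⊥ := by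
  refine radical_chartForm_comp_eq_bot (h.injective_mixedCoord hψ ht)
    (graphForm_rotatedGraph (hψ.omega_mulVec hP ht) 0) fun z h1 h2 => ?_
  rw [rotatedGraph_zero] at h1 h2
  simp only at h1 h2
  rcases ht.1.eq_or_lt with rfl | h0
  · obtain rfl : θ = 0 := hA.resolve_right fun h => lt_irrefl _ h.1
    rw [zero_smul] at h1 h2
    rw [hψ.1, Matrix.one_mulVec] at h2
    ext (i | i)
    · exact congrFun h1 i
    · exact congrFun h2 i
  · refine h.eq_zero hψ ⟨h0, ht.2⟩ ?_
    rcases hA with rfl | ⟨-, hA⟩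
    · rw [zero_smul] at h1 h2
      rw [h1, h2, zero_dotProduct, Matrix.mulVec_zero, dotProduct_zero]
    · rw [h2, h1, Matrix.mulVec_smul, Matrix.mulVec_mulVec, hA, ← Matrix.mulVec_mulVec,
        dotProduct_smul, smul_dotProduct, Matrix.dotProduct_mulVec, Matrix.mulVec_transpose]

/-- The positive index at the final time is `n`, by homotopy to the form `2 x·y`. -/
theorem SeparatesTimes.eventually_sigPos_final (h : SeparatesTimes P s T) (hT : 0 < T)
    (hψ : IsFundamentalSolution (hamB P s) T ψ) (hP : ∀ t ∈ Icc 0 T, (P t).IsSymm)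
    {A : Matrix (Fin n) (Fin n) ℝ} (hA : (P 0)⁻¹ * A = A * (P T)⁻¹) :
    ∀ᶠ ε in 𝓝 (0 : ℝ), sigPos ((chartForm A 1).comp (rotatedGraph (ψ T) ε)) = n ∧
      ((chartForm A 1).comp (rotatedGraph (ψ T) ε)).radical = ⊥ := by
  have hT' : T ∈ Icc 0 T := right_mem_Icc.2 hT.le
  have h1 : sigPos ((chartForm A 0).comp (rotatedGraph (ψ T) 0)) = n := by
    have h0 := sigPos_eq_of_continuousOn (Q := fun t => (chartForm A 0).comp (rotatedGraph (ψ t) 0))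
      isPreconnected_Icc
      (fun z => (continuous_chartForm A 0).comp_continuousOn (continuousOn_rotatedGraph hψ 0 z))
      (fun t ht => h.radical_eq_bot hψ hP ht (Or.inl rfl)) hT' (left_mem_Icc.2 hT.le)
    simp only [hψ.1] at h0
    exact h0.trans (sigPos_chartForm_zero A)
  have hrad : ∀ θ, ((chartForm A θ).comp (rotatedGraph (ψ T) 0)).radical = ⊥ := fun θ =>
    h.radical_eq_bot hψ hP hT' (Or.inr ⟨hT, hA⟩)
  have h2 : sigPos ((chartForm A 1).comp (rotatedGraph (ψ T) 0)) = n := by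
    refine (sigPos_eq_of_continuousOn (Q := fun θ => (chartForm A θ).comp (rotatedGraph (ψ T) 0))
      isPreconnected_univ (fun z => ?_) (fun θ _ => hrad θ) (mem_univ _) (mem_univ _)).trans h1
    simp only [QuadraticMap.comp_apply, chartForm_apply]
    fun_prop
  filter_upwards [eventually_sigPos_eq_of_tendsto
    (Q := fun ε => (chartForm A 1).comp (rotatedGraph (ψ T) ε))
    (Q₀ := (chartForm A 1).comp (rotatedGraph (ψ T) 0))
    (fun z => ((continuous_chartForm A 1).comp
      (continuous_rotatedGraph_apply continuous_const continuous_id z)).tendsto 0) (hrad 1)]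
    with ε hε
  exact ⟨hε.1.trans h2, hε.2⟩

end Final

end SturmMaslov

open SturmMaslov

theorem mainTheorem3 (n : ℕ) (T : ℝ) (hT : 0 < T)
    (P : ℝ → Matrix (Fin n) (Fin n) ℝ) (A : Matrix (Fin n) (Fin n) ℝ)
    (hP_smooth : ∀ i j, ContDiffOn ℝ 1 (fun t => P t i j) (Set.Icc 0 T))
    (hP_symm : ∀ t ∈ Set.Icc 0 T, (P t).IsSymm)
    (hP_nondeg : ∀ t ∈ Set.Icc 0 T, IsUnit (P t).det)
    (hA : A ∈ Matrix.orthogonalGroup (Fin n) ℝ)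
    (hPA : P 0 = A * P T * A.transpose) :
    ∃ σ : ℝ, 0 ≤ σ ∧ ∀ s₀ : ℝ, σ ≤ s₀ →
      ∀ ψ : ℝ → Matrix (Fin n ⊕ Fin n) (Fin n ⊕ Fin n) ℝ,
        SturmMaslov.IsFundamentalSolution (SturmMaslov.hamB P s₀) T ψ →
        ∀ k : ℤ,
          SturmMaslov.IsCLMIndex (SturmMaslov.graphForm n) (SturmMaslov.graphJ n)
              (SturmMaslov.Gr (SturmMaslov.diag₂ A).transpose)
              (fun t => SturmMaslov.Gr (ψ t)) 0 T k ↔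
            k = (Module.finrank ℝ (LinearMap.ker (A - 1).mulVecLin) : ℤ) := by
  obtain ⟨σ, hσ, hsep⟩ := exists_threshold hT hP_smooth hP_nondeg
  refine ⟨σ, hσ, fun s hs ψ hψ k => ?_⟩
  have hsep : SeparatesTimes P s T := hsep s hs
  have hAA : Aᵀ * A = 1 := (Matrix.mem_orthogonalGroup_iff' _ _).1 hA
  have hAA' : A * Aᵀ = 1 := (Matrix.mem_orthogonalGroup_iff _ _).1 hA
  have hT0 : (0 : ℝ) ∈ Icc 0 T := left_mem_Icc.2 hT.le
  have hTT : T ∈ Icc 0 T := right_mem_Icc.2 hT.le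
  have hAP : (P 0)⁻¹ * A = A * (P T)⁻¹ := by
    have h1 : (P 0)⁻¹ = A * (P T)⁻¹ * Aᵀ := by
      refine Matrix.inv_eq_right_inv ?_
      calc P 0 * (A * (P T)⁻¹ * Aᵀ) = A * (P T * (Aᵀ * A) * (P T)⁻¹) * Aᵀ := by
            rw [hPA]; simp only [Matrix.mul_assoc]
        _ = 1 := by
            rw [hAA, Matrix.mul_one, Matrix.mul_nonsing_inv _ (hP_nondeg T hTT), Matrix.mul_one,
              hAA']
    rw [h1, Matrix.mul_assoc, hAA, Matrix.mul_one]
  have hiso : ∀ ε, ∀ t ∈ Icc 0 T, ∀ z z',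
      graphForm n (rotatedGraph (ψ t) ε z) (rotatedGraph (ψ t) ε z') = 0 := fun ε t ht =>
    graphForm_rotatedGraph (hψ.omega_mulVec hP_symm ht) ε
  have hinit := eventually_sigPos_initial hA
  rw [← hψ.1] at hinit
  -- For small `ε > 0` the rotated path has exactly one intersection number.
  have key : ∀ᶠ ε in 𝓝[>] (0 : ℝ), ∀ k : ℤ,
      IsIntersectionNumber (graphForm n) (Gr (diag₂ A)ᵀ)
        (fun t => (Gr (ψ t)).map (rotation (graphJ n) (-ε))) 0 T k ↔
      k = (Module.finrank ℝ (LinearMap.ker (A - 1).mulVecLin) : ℤ) := by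
    filter_upwards [hinit, (hsep.eventually_sigPos_final hT hψ hP_symm hAP).filter_mono
      nhdsWithin_le_nhds, (hsep.eventually_injective_mixedCoord hψ).filter_mono
      nhdsWithin_le_nhds] with ε h0 h1 hinj k
    simp only [← range_rotatedGraph]
    have hval : (chartCoindex (graphForm n) (Gr (diag₂ A)ᵀ) (mixedPlane n)
          (LinearMap.range (rotatedGraph (ψ T) ε)) : ℤ)
        - chartCoindex (graphForm n) (Gr (diag₂ A)ᵀ) (mixedPlane n)
          (LinearMap.range (rotatedGraph (ψ 0) ε))
        = (Module.finrank ℝ (LinearMap.ker (A - 1).mulVecLin) : ℤ) := by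
      rw [chartCoindex_range_eq hA (hinj T hTT), chartCoindex_range_eq hA (hinj 0 hT0)]
      omega
    rw [← hval]
    constructor
    · intro hk
      exact hk.eq_chartCoindex_sub (Φ := fun t => rotatedGraph (ψ t) ε) graphForm_skew
        (isLagrangian_Gr hA) isLagrangian_mixedPlane (isCompl_mixedPlane_Gr hA)
        (continuousOn_rotatedGraph hψ ε)
        (fun t ht => Function.Injective.of_comp (f := mixedCoord n) (hinj t ht)) (hiso ε)
        (fun t ht => isCompl_mixedPlane_range (hinj t ht))
    · rintro rfl
      exact isIntersectionNumber_of_chart (ℓ := fun t => LinearMap.range (rotatedGraph (ψ t) ε))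
        isLagrangian_mixedPlane (isCompl_mixedPlane_Gr hA) hT.le
        (fun t ht => isCompl_mixedPlane_range (hinj t ht))
        (range_inf_Gr_eq_bot hA (hiso ε 0 hT0) h0.2) (range_inf_Gr_eq_bot hA (hiso ε T hTT) h1.2)
  constructor
  · rintro ⟨ε₀, hε₀, h⟩
    obtain ⟨ε, hε, hmem⟩ := (key.and (Ioo_mem_nhdsGT hε₀)).exists
    exact (hε k).1 (h ε hmem)
  · rintro rfl
    obtain ⟨ε₀, hε₀, h⟩ := (mem_nhdsGT_iff_exists_Ioo_subset).1 key
    exact ⟨ε₀, hε₀, fun ε hε => (h hε _).2 rfl⟩
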